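/- Let $M\subset B(H)$ be a finite factor (a von Neumann algebra on a complex Hilbert space $H$), let $\tau$ be its faithful normal tracial state, and let $\alpha$ be an involutive $*$-antiautomorphism of $M$, i.e. a complex linear map with $\alpha(x^*)=\alpha(x)^*$, $\alpha(xy)=\alpha(y)\alpha(x)$ and $\alpha(\alpha(x))=x$. Put $(M,\alpha)=\{x\in M:\alpha(x)=x^*\}$. Let $L^2(M)$ be the completion of $M$ in the norm $\|x\|_2=\tau(x^*x)^{1/2}$, and let $L^2(M,\alpha)$ be the completion of $(M,\alpha)$ in this norm, i.e. the closure of $(M,\alpha)$ in $L^2(M)$, a real Hilbert space. Write $B_r(L^2(M,\alpha))$ for the algebra of bounded real linear operators on $L^2(M,\alpha)$. Let $\lambda(x)\in B(L^2(M))$ be the extension of $y\mapsto xy$ for $x\in M$, let $\lambda_r(x)\in B_r(L^2(M,\alpha))$ be the extension of $y\mapsto xy$ (on $(M,\alpha)$) for $x\in(M,\alpha)$, let $J$ be the conjugate linear isometry of $L^2(M)$ extending $x\mapsto x^*$, and let $\lambda(M)'$ be the commutant of $\lambda(M)$ in $B(L^2(M))$. Define $\beta(\lambda(x))=\lambda(\alpha(x))$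 on $\lambda(M)$, $\beta'(T)=J\beta(JTJ)J$ on $\lambda(M)'=J\lambda(M)J$, and $$\lambda_r(M,\alpha)'=\{T\in\lambda(M)' : \beta'(T)=T^*\}.$$ Then: 1. $\lambda_r(M,\alpha)'$ is a real W$^*$-algebra on $L^2(M)$, i.e. a real $*$-subalgebra of $B(L^2(M))$ that contains the identity, is closed in the weak operator topology and satisfies $\lambda_r(M,\alpha)'\cap i\lambda_r(M,\alpha)'=\{0\}$. 2. Every $S\in B_r(L^2(M,\alpha))$ has exactly one extension to a bounded complex linear operator on $L^2(M)$; by means of this extension $B_r(L^2(M,\alpha))$ is regarded as a subset of $B(L^2(M))$. 3. With this identification, $\lambda_r(M,\alpha)'$ is exactly the commutant of $\lambda_r(M,\alpha)$ in $B_r(L^2(M,\alpha))$: $$\lambda_r(M,\alpha)'=\{S\in B_r(L^2(M,\alpha)) : S\lambda_r(x)=\lambda_r(x)S \text{ for all } x\in(M,\alpha)\}.$$ -/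

import Mathlib

open scoped ComplexOrder InnerProductSpace

noncomputable section

/-! ### A concrete von Neumann algebra as an ordered C⋆-algebra -/

namespace VonNeumannAlgebra

variable {H : Type*} [NormedAddCommGroup H] [InnerProductSpace ℂ H] [CompleteSpace H]

instance instSMulMemClassComplex : SMulMemClass (VonNeumannAlgebra H) ℂ (H →L[ℂ] H) where
  smul_mem {s} r _ hx := s.toStarSubalgebra.smul_mem hx r

theorem isClosed_coe (M : VonNeumannAlgebra H) : IsClosed (M : Set (H →L[ℂ] H)) := by
  rw [← centralizer_centralizer M]
  exact Set.isClosed_centralizer _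

instance instCStarAlgebra (M : VonNeumannAlgebra H) : CStarAlgebra M :=
  haveI := M.isClosed_coe
  StarSubalgebra.cstarAlgebra M

/-- The order of `M` is the one inherited from the operator order of `B(H)`. -/
instance instStarOrderedRing (M : VonNeumannAlgebra H) : StarOrderedRing M :=
  StarOrderedRing.of_nonneg_iff'
    (fun {x y} h z => by
      have h' : (x : H →L[ℂ] H) ≤ y := h
      change ((z + x : M) : H →L[ℂ] H) ≤ ((z + y : M) : H →L[ℂ] H)
      exact add_le_add_right h' (z : H →L[ℂ] H))
    (fun x => by
      constructor
      · intro h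
        have h' : 0 ≤ (x : H →L[ℂ] H) := h
        have hs : CFC.sqrt (x : H →L[ℂ] H) ∈ M := by
          refine (SetLike.ext_iff.1 (commutant_commutant M) _).1 (mem_commutant_iff.2 ?_)
          intro g hg
          have hc : Commute (x : H →L[ℂ] H) g := mem_commutant_iff.1 hg x x.2
          have := Commute.cfcₙ_nnreal hc NNReal.sqrt
          exact this.symm
        refine ⟨⟨CFC.sqrt (x : H →L[ℂ] H), hs⟩, Subtype.ext ?_⟩
        have h1 : star (CFC.sqrt (x : H →L[ℂ] H)) = CFC.sqrt (x : H →L[ℂ] H) :=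
          (IsSelfAdjoint.of_nonneg (CFC.sqrt_nonneg _)).star_eq
        change (x : H →L[ℂ] H) = star (CFC.sqrt (x : H →L[ℂ] H)) * CFC.sqrt (x : H →L[ℂ] H)
        rw [h1, CFC.sqrt_mul_sqrt_self (x : H →L[ℂ] H) h']
      · rintro ⟨s, rfl⟩
        change 0 ≤ star (s : H →L[ℂ] H) * (s : H →L[ℂ] H)
        exact star_mul_self_nonneg _)

/-- `M` is a finite factor: the center is `ℂ 1`, the algebra is not zero, and every isometry
in `M` is a unitary. -/
structure IsFiniteFactor (M : VonNeumannAlgebra H) : Prop where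
  one_ne_zero : (1 : H →L[ℂ] H) ≠ 0
  center_trivial : ∀ z ∈ M, z ∈ M.commutant → ∃ c : ℂ, z = c • (1 : H →L[ℂ] H)
  finite : ∀ v ∈ M, star v * v = 1 → v * star v = 1

/-- `τ` is a faithful normal tracial state of `M`. Normality is `σ`-weak continuity: `τ` is of
the form `x ↦ ∑ ⟨x ξₙ, ηₙ⟩` with `∑ ‖ξₙ‖² < ∞` and `∑ ‖ηₙ‖² < ∞`. -/
structure IsFaithfulNormalTracialState (M : VonNeumannAlgebra H) (τ : M →ₚ[ℂ] ℂ) : Prop where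
  map_one : τ 1 = 1
  tracial : ∀ x y : M, τ (x * y) = τ (y * x)
  faithful : ∀ x : M, τ (star x * x) = 0 → x = 0
  normal : ∃ ξ η : ℕ → H, Summable (fun n => ‖ξ n‖ ^ 2) ∧ Summable (fun n => ‖η n‖ ^ 2) ∧
    ∀ x : M, HasSum (fun n => ⟪η n, (x : H →L[ℂ] H) (ξ n)⟫_ℂ) (τ x)

end VonNeumannAlgebra

/-- An involutive `*`-antiautomorphism of a complex `*`-algebra. -/
structure InvolutiveStarAntiaut (A : Type*) [Semiring A] [StarRing A] [Module ℂ A] where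
  toLinearMap : A →ₗ[ℂ] A
  map_star : ∀ x, toLinearMap (star x) = star (toLinearMap x)
  map_mul : ∀ x y, toLinearMap (x * y) = toLinearMap y * toLinearMap x
  involutive : ∀ x, toLinearMap (toLinearMap x) = x

instance {A : Type*} [Semiring A] [StarRing A] [Module ℂ A] :
    CoeFun (InvolutiveStarAntiaut A) (fun _ => A → A) where
  coe α := α.toLinearMap

namespace InvolutiveStarAntiaut

/-- The real algebra `(M, α) = {x ∈ M : α(x) = x^*}`. -/
def realAlgebra {A : Type*} [Semiring A] [StarRing A] [Module ℂ A]
    (α : InvolutiveStarAntiaut A) : Set A :=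
  {x | α x = star x}

end InvolutiveStarAntiaut

/-! ### The space `L²(M)`, the left representation and the conjugation `J` -/

namespace TraceRep

section Algebra

variable {A : Type*} [CStarAlgebra A] [PartialOrder A] [StarOrderedRing A] (τ : A →ₚ[ℂ] ℂ)

/-- `L²(A)`: the completion of `A` for `⟨x, y⟩ = τ(x^* y)`, so that `‖x‖₂ = τ(x^* x)^{1/2}`. -/
def L2 : Type _ := τ.GNS

instance : NormedAddCommGroup (L2 τ) := inferInstanceAs (NormedAddCommGroup τ.GNS)
instance : InnerProductSpace ℂ (L2 τ) := inferInstanceAs (InnerProductSpace ℂ τ.GNS)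
instance : CompleteSpace (L2 τ) := inferInstanceAs (CompleteSpace τ.GNS)

/-- The canonical map `A → L²(A)`. -/
def toL2 : A →ₗ[ℂ] L2 τ where
  toFun x := ((τ.toPreGNS x : τ.PreGNS) : τ.GNS)
  map_add' x y := by
    rw [_root_.map_add]; exact UniformSpace.Completion.coe_add _ _
  map_smul' c x := by
    rw [_root_.map_smul]; exact UniformSpace.Completion.coe_smul _ _

theorem denseRange_toL2 : DenseRange (toL2 τ) :=
  UniformSpace.Completion.denseRange_coe (α := τ.PreGNS)

theorem inner_toL2 (x y : A) : ⟪toL2 τ x, toL2 τ y⟫_ℂ = τ (star x * y) :=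
  UniformSpace.Completion.inner_coe (𝕜 := ℂ) (τ.toPreGNS x) (τ.toPreGNS y)

/-- The left regular representation `λ : A → B(L²(A))`. -/
def lam : A →⋆ₐ[ℂ] (L2 τ →L[ℂ] L2 τ) := τ.gnsStarAlgHom

theorem lam_toL2 (x y : A) : lam τ x (toL2 τ y) = toL2 τ (x * y) :=
  τ.gnsNonUnitalStarAlgHom_apply_coe (a := x) (b := τ.toPreGNS y)

variable {τ}

/-- The map `x ↦ x^*` before completion. -/
def preJ (hτ : ∀ x y : A, τ (x * y) = τ (y * x)) : τ.PreGNS →L⋆[ℂ] τ.PreGNS :=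
  LinearMap.mkContinuous
    { toFun := fun x => τ.toPreGNS (star (τ.ofPreGNS x))
      map_add' := fun x y => by simp
      map_smul' := fun c x => by simp } 1 (fun x => by
        rw [one_mul]
        apply le_of_eq
        simp [PositiveLinearMap.preGNS_norm_def, hτ])

/-- The conjugate linear isometry `J` of `L²(A)` that extends `x ↦ x^*`. -/
def J (hτ : ∀ x y : A, τ (x * y) = τ (y * x)) : L2 τ →L⋆[ℂ] L2 τ :=
  (preJ hτ).completion

theorem J_toL2 (hτ : ∀ x y : A, τ (x * y) = τ (y * x)) (x : A) :
    J hτ (toL2 τ x) = toL2 τ (star x) :=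
  ContinuousLinearMap.completion_apply_coe (preJ hτ) (τ.toPreGNS x)

/-- The (complex linear) operator `J T J`. -/
def conjJ (hτ : ∀ x y : A, τ (x * y) = τ (y * x)) (T : L2 τ →L[ℂ] L2 τ) : L2 τ →L[ℂ] L2 τ :=
  (J hτ).comp (T.comp (J hτ))

/-- The commutant `λ(A)'` in `B(L²(A))`. -/
def lamCommutant (τ : A →ₚ[ℂ] ℂ) : Set (L2 τ →L[ℂ] L2 τ) :=
  Set.centralizer (Set.range (lam τ))

/-- The map `β : λ(A) → λ(A)`, `β(λ(x)) = λ(α(x))`, with value `0` outside `λ(A)`. It is only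
used for a faithful `τ`, where `λ` is injective. -/
def beta (τ : A →ₚ[ℂ] ℂ) (α : InvolutiveStarAntiaut A) :
    (L2 τ →L[ℂ] L2 τ) → (L2 τ →L[ℂ] L2 τ) :=
  Function.extend (lam τ) (fun x => lam τ (α x)) 0

theorem lam_injective (hf : ∀ x : A, τ (star x * x) = 0 → x = 0) :
    Function.Injective (lam τ) := by
  rw [injective_iff_map_eq_zero]
  intro x hx
  apply hf
  have h : toL2 τ x = 0 := by
    have := lam_toL2 τ x 1
    rw [hx, mul_one] at this
    simpa using this.symm
  rw [← inner_toL2, h, inner_zero_left]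

theorem beta_lam (hf : ∀ x : A, τ (star x * x) = 0 → x = 0)
    (α : InvolutiveStarAntiaut A) (x : A) : beta τ α (lam τ x) = lam τ (α x) :=
  (lam_injective hf).extend_apply _ _ x

/-- The map `β'(T) = J β(J T J) J` on `λ(A)'`. -/
def betaPrime (hτ : ∀ x y : A, τ (x * y) = τ (y * x)) (α : InvolutiveStarAntiaut A)
    (T : L2 τ →L[ℂ] L2 τ) : L2 τ →L[ℂ] L2 τ :=
  conjJ hτ (beta τ α (conjJ hτ T))

/-- The algebra `λ_r(M, α)' = {T ∈ λ(M)' : β'(T) = T^*}`. -/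
def realCommutant (hτ : ∀ x y : A, τ (x * y) = τ (y * x)) (α : InvolutiveStarAntiaut A) :
    Set (L2 τ →L[ℂ] L2 τ) :=
  {T | T ∈ lamCommutant τ ∧ betaPrime hτ α T = star T}

/-! ### The real Hilbert space `L²(M, α)` -/

/-- `(M, α)` as a real linear subspace of `M`. -/
def realAlgebraSubmodule (α : InvolutiveStarAntiaut A) : Submodule ℝ A where
  carrier := α.realAlgebra
  add_mem' {x y} hx hy := by
    simp only [InvolutiveStarAntiaut.realAlgebra, Set.mem_ofPred_eq] at *
    rw [_root_.map_add, hx, hy, star_add]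
  zero_mem' := by simp [InvolutiveStarAntiaut.realAlgebra]
  smul_mem' c x hx := by
    simp only [InvolutiveStarAntiaut.realAlgebra, Set.mem_ofPred_eq] at *
    rw [← Complex.coe_smul, _root_.map_smul, hx, star_smul]
    simp

/-- `L²(M, α)`: the completion of `(M, α)` in the norm `‖·‖₂`, realised as the closure of
`(M, α)` in `L²(M)`. -/
def realL2 (τ : A →ₚ[ℂ] ℂ) (α : InvolutiveStarAntiaut A) : Submodule ℝ (L2 τ) :=
  ((realAlgebraSubmodule α).map ((toL2 τ).restrictScalars ℝ)).topologicalClosure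

instance (τ : A →ₚ[ℂ] ℂ) (α : InvolutiveStarAntiaut A) : CompleteSpace (realL2 τ α) :=
  (Submodule.isClosed_topologicalClosure _).completeSpace_coe

/-- `L²(M, α)` is a real Hilbert space for the real part of the inner product of `L²(M)`. -/
instance (τ : A →ₚ[ℂ] ℂ) (α : InvolutiveStarAntiaut A) : InnerProductSpace ℝ (realL2 τ α) :=
  letI : InnerProductSpace ℝ (L2 τ) := InnerProductSpace.complexToReal
  Submodule.innerProductSpace (realL2 τ α)

theorem toL2_mem_realL2 (τ : A →ₚ[ℂ] ℂ) (α : InvolutiveStarAntiaut A) {x : A}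
    (hx : x ∈ α.realAlgebra) : toL2 τ x ∈ realL2 τ α :=
  Submodule.le_topologicalClosure _ ⟨x, hx, rfl⟩

theorem lam_mem_realL2 (τ : A →ₚ[ℂ] ℂ) (α : InvolutiveStarAntiaut A) {x : A}
    (hx : x ∈ α.realAlgebra) {v : L2 τ} (hv : v ∈ realL2 τ α) : lam τ x v ∈ realL2 τ α := by
  refine map_mem_closure (lam τ x).continuous hv ?_
  rintro _ ⟨y, hy, rfl⟩
  refine ⟨x * y, ?_, (lam_toL2 τ x y).symm⟩
  change α (x * y) = star (x * y)
  have hx' : α x = star x := hx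
  have hy' : α y = star y := hy
  rw [α.map_mul, hx', hy', star_mul]

/-- `B_r(L²(M, α))`: the bounded operators on the real Hilbert space `L²(M, α)`. -/
abbrev RealOps (τ : A →ₚ[ℂ] ℂ) (α : InvolutiveStarAntiaut A) : Type _ :=
  realL2 τ α →L[ℝ] realL2 τ α

/-- `λ_r(x)` for `x ∈ (M, α)`: the operator on `L²(M, α)` that extends `y ↦ x y`. -/
def lamR (τ : A →ₚ[ℂ] ℂ) (α : InvolutiveStarAntiaut A) (x : α.realAlgebra) : RealOps τ α :=
  ((lam τ (x : A)).restrictScalars ℝ).restrict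
    (fun _ hv => lam_mem_realL2 τ α x.2 hv)

theorem lamR_toL2 (τ : A →ₚ[ℂ] ℂ) (α : InvolutiveStarAntiaut A) (x y : α.realAlgebra) :
    (lamR τ α x ⟨toL2 τ (y : A), toL2_mem_realL2 τ α y.2⟩ : L2 τ) = toL2 τ ((x : A) * y) :=
  lam_toL2 τ (x : A) y

/-- The commutant of `λ_r(M, α)` in `B_r(L²(M, α))`. -/
def commutantInRealOps (τ : A →ₚ[ℂ] ℂ) (α : InvolutiveStarAntiaut A) : Set (RealOps τ α) :=
  {S | ∀ x : α.realAlgebra, S * lamR τ α x = lamR τ α x * S}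

/-- `T ∈ B(L²(M))` is the complex linear extension of `S ∈ B_r(L²(M, α))`. -/
def IsComplexification {τ : A →ₚ[ℂ] ℂ} {α : InvolutiveStarAntiaut A}
    (S : RealOps τ α) (T : L2 τ →L[ℂ] L2 τ) : Prop :=
  ∀ v : realL2 τ α, T v = S v

end Algebra

end TraceRep

/-- A real W⋆-algebra on a complex Hilbert space `K`: a unital real `*`-subalgebra `R` of `B(K)`
that is closed in the weak operator topology and satisfies `R ∩ iR = 0`. -/
structure IsRealWStarAlgebra {K : Type*} [NormedAddCommGroup K] [InnerProductSpace ℂ K]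
    [CompleteSpace K] (R : Set (K →L[ℂ] K)) : Prop where
  one_mem : 1 ∈ R
  add_mem : ∀ S ∈ R, ∀ T ∈ R, S + T ∈ R
  smul_mem : ∀ (c : ℝ), ∀ T ∈ R, c • T ∈ R
  mul_mem : ∀ S ∈ R, ∀ T ∈ R, S * T ∈ R
  star_mem : ∀ T ∈ R, star T ∈ R
  isClosed : IsClosed {T : K →WOT[ℂ] K | T.toCLM ∈ R}
  inter_eq_zero : ∀ T ∈ R, Complex.I • T ∈ R → T = 0

end

/-! The whole argument rests on the conjugation `C` of `L²(M)` extending `x ↦ α(x)^*`. If `τ ∘ α =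
τ`, then `C` is a conjugate linear isometric involution. Averaging `v` with `C v` shows that its
fixed points are exactly `L²(M, α)`, so `L²(M)` is the complexification of `L²(M, α)`. This gives
the unique extensions.

By the commutation theorem (`exists_right_mul_of_mem_lamCommutant`) each `T` in `λ(M)'` is right
multiplication by some `z` in `M`. Then `T^*` is right multiplication by `z^*` and `β'(T)` by
`α(z)`, so `β'(T) = T^*` means `α(z) = z^*`, which is to say that `T` commutes with `C`
(`mem_realCommutant_iff`). Both remaining claims follow: commuting with `λ(M)` and with `C` are
weakly closed conditions, and the operators commuting with `C` are the complexifications of real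
operators on `L²(M, α)`.

The invariance `τ ∘ α = τ` (`trace_comp_antiaut`) needs some continuity of `α`. Since `α` is an
order isomorphism, `τ ∘ α` is absolutely continuous with respect to `τ` (`exists_comp_lt`). In a
factor, unitary averages of `x` approach `τ(x) 1` in `L²`, and the trace `τ ∘ α` is constant on
these averages. -/

noncomputable section

/-! ### Weak operator limits along an ultrafilter. -/

section UltrafilterLimit

open Filter Topology

variable {E : Type*} [NormedAddCommGroup E] [InnerProductSpace ℂ E]

/-- A bounded sequence of operators converges in the weak operator topology along any
ultrafilter. -/
theorem ContinuousLinearMap.exists_tendsto_inner_of_norm_le [CompleteSpace E] (U : Ultrafilter ℕ) {r : ℝ}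
    {x : ℕ → E →L[ℂ] E} (hx : ∀ n, ‖x n‖ ≤ r) :
    ∃ y : E →L[ℂ] E, ‖y‖ ≤ r ∧
      ∀ ζ η, Tendsto (fun n => ⟪ζ, x n η⟫_ℂ) U (𝓝 ⟪ζ, y η⟫_ℂ) := by
  have hr : 0 ≤ r := (norm_nonneg _).trans (hx 0)
  have hb : ∀ ζ η n, ‖⟪x n ζ, η⟫_ℂ‖ ≤ r * ‖ζ‖ * ‖η‖ := fun ζ η n =>
    (norm_inner_le_norm _ _).trans
      (mul_le_mul_of_nonneg_right ((x n).le_of_opNorm_le (hx n) ζ) (norm_nonneg _))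
  have hlim : ∀ ζ η, ∃ c : ℂ, Tendsto (fun n => ⟪x n ζ, η⟫_ℂ) U (𝓝 c) := by
    intro ζ η
    obtain ⟨c, -, hc⟩ := (isCompact_closedBall (0 : ℂ) (r * ‖ζ‖ * ‖η‖)).ultrafilter_le_nhds
      (U.map fun n => ⟪x n ζ, η⟫_ℂ) (by
        rw [Ultrafilter.coe_map, le_principal_iff]
        exact mem_map.2 (univ_mem' fun n => by simpa using hb ζ η n))
    exact ⟨c, hc⟩
  choose B hB using hlim
  -- The limits of the matrix coefficients form a bounded sesquilinear form, which the Riesz theorem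
  -- represents by an operator.
  let B' : E →L⋆[ℂ] E →L[ℂ] ℂ := LinearMap.mkContinuous₂
    (LinearMap.mk₂'ₛₗ (starRingEnd ℂ) (RingHom.id ℂ) B
      (fun a b c => tendsto_nhds_unique (hB _ _) (by
        simpa [inner_add_left] using (hB a c).add (hB b c)))
      (fun c a b => tendsto_nhds_unique (hB _ _) (by
        simpa [inner_smul_left, mul_comm] using (hB a b).const_mul ((starRingEnd ℂ) c)))
      (fun a b c => tendsto_nhds_unique (hB _ _) (by
        simpa [inner_add_right] using (hB a b).add (hB a c)))
      (fun c a b => tendsto_nhds_unique (hB _ _) (by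
        simpa [inner_smul_right] using (hB a b).const_mul c))) r
      (fun a b => le_of_tendsto (hB a b).norm (Eventually.of_forall (hb a b)))
  have hB' : ∀ ζ η, Tendsto (fun n => ⟪x n ζ, η⟫_ℂ) U
      (𝓝 ⟪InnerProductSpace.continuousLinearMapOfBilin B' ζ, η⟫_ℂ) := by
    intro ζ η
    rw [InnerProductSpace.continuousLinearMapOfBilin_apply]
    exact hB ζ η
  refine ⟨InnerProductSpace.continuousLinearMapOfBilin B', ?_, fun ζ η => ?_⟩
  · refine ContinuousLinearMap.opNorm_le_of_re_inner_le hr fun ζ η hζ hη => ?_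
    refine (RCLike.re_le_norm _).trans ?_
    exact le_of_tendsto (hB' ζ η).norm
      (Eventually.of_forall fun n => by simpa [hζ, hη] using hb ζ η n)
  · simpa only [Function.comp_def, inner_conj_symm] using
      (Complex.continuous_conj.tendsto _).comp (hB' η ζ)

/-- Order bounds pass to limits in the weak operator topology. -/
theorem ContinuousLinearMap.nonneg_of_tendsto_inner (U : Ultrafilter ℕ)
    {x : ℕ → E →L[ℂ] E} {y : E →L[ℂ] E}
    (h : ∀ ζ η, Tendsto (fun n => ⟪ζ, x n η⟫_ℂ) U (𝓝 ⟪ζ, y η⟫_ℂ))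
    (hx : ∀ᶠ n in (U : Filter ℕ), 0 ≤ x n) : 0 ≤ y := by
  rw [ContinuousLinearMap.nonneg_iff_isPositive, ContinuousLinearMap.isPositive_iff]
  refine ⟨fun ζ η => ?_, fun ζ => ?_⟩
  · have h1 : Tendsto (fun n => ⟪x n ζ, η⟫_ℂ) U (𝓝 ⟪y ζ, η⟫_ℂ) := by
      simpa only [Function.comp_def, inner_conj_symm] using
        (Complex.continuous_conj.tendsto _).comp (h η ζ)
    refine tendsto_nhds_unique h1 ((h ζ η).congr' ?_)
    filter_upwards [hx] with n hn
    rw [ContinuousLinearMap.nonneg_iff_isPositive] at hn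
    exact (hn.isSymmetric ζ η).symm
  · have h1 : Tendsto (fun n => ⟪x n ζ, ζ⟫_ℂ) U (𝓝 ⟪y ζ, ζ⟫_ℂ) := by
      simpa only [Function.comp_def, inner_conj_symm] using
        (Complex.continuous_conj.tendsto _).comp (h ζ ζ)
    refine ge_of_tendsto h1 ?_
    filter_upwards [hx] with n hn
    rw [ContinuousLinearMap.nonneg_iff_isPositive] at hn
    exact hn.inner_nonneg_left ζ

end UltrafilterLimit

/-! ### Compactness of the balls of a von Neumann algebra. -/

section BallCompact

open Filter Topology

/-- The balls of `A` are compact for the `τ`-weak topology, and order intervals are closed. -/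
def IsBallCompact {A : Type*} [CStarAlgebra A] [PartialOrder A] [StarOrderedRing A]
    (τ : A →ₚ[ℂ] ℂ) : Prop :=
  ∀ (r : ℝ) (x : ℕ → A), (∀ n, ‖x n‖ ≤ r) → ∃ y : A, ‖y‖ ≤ r ∧
    (∀ a, Tendsto (fun n => τ (a * x n)) (hyperfilter ℕ) (𝓝 (τ (a * y)))) ∧
    (∀ z, (∀ᶠ n in (hyperfilter ℕ : Filter ℕ), z ≤ x n) → z ≤ y) ∧
    (∀ z, (∀ᶠ n in (hyperfilter ℕ : Filter ℕ), x n ≤ z) → y ≤ z)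

variable {H : Type*} [NormedAddCommGroup H] [InnerProductSpace ℂ H] [CompleteSpace H]

theorem VonNeumannAlgebra.mem_of_tendsto_inner (M : VonNeumannAlgebra H) (U : Ultrafilter ℕ)
    {x : ℕ → H →L[ℂ] H} {y : H →L[ℂ] H} (hx : ∀ n, x n ∈ M)
    (h : ∀ ζ η, Tendsto (fun n => ⟪ζ, x n η⟫_ℂ) U (𝓝 ⟪ζ, y η⟫_ℂ)) : y ∈ M := by
  rw [← VonNeumannAlgebra.commutant_commutant M, VonNeumannAlgebra.mem_commutant_iff]
  intro g hg
  ext η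
  refine ext_inner_left ℂ fun ζ => ?_
  have h1 := h (star g ζ) η
  have h2 := h ζ (g η)
  simp only [ContinuousLinearMap.star_eq_adjoint, ContinuousLinearMap.adjoint_inner_left] at h1
  refine tendsto_nhds_unique h1 (h2.congr fun n => ?_)
  have := VonNeumannAlgebra.mem_commutant_iff.1 hg (x n) (hx n)
  exact congrArg (fun T : H →L[ℂ] H => ⟪ζ, T η⟫_ℂ) this

/-- Normality is used here: it writes `τ(a xₙ)` as a series of matrix coefficients, each of which
converges, with a summable bound uniform in `n`. The order bounds hold because the positive cone is
weakly closed. -/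
theorem VonNeumannAlgebra.IsFaithfulNormalTracialState.isBallCompact {M : VonNeumannAlgebra H}
    {τ : M →ₚ[ℂ] ℂ} (hτ : M.IsFaithfulNormalTracialState τ) : IsBallCompact τ := by
  intro r x hx
  obtain ⟨y, hyr, hy⟩ := ContinuousLinearMap.exists_tendsto_inner_of_norm_le (hyperfilter ℕ)
    (x := fun n => (x n : H →L[ℂ] H)) hx
  have hyM : y ∈ M := M.mem_of_tendsto_inner _ (fun n => (x n).2) hy
  refine ⟨⟨y, hyM⟩, hyr, fun a => ?_, fun z hz => ?_, fun z hz => ?_⟩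
  · obtain ⟨ξ, η, hξ, hη, hs⟩ := hτ.normal
    have hr : 0 ≤ r := (norm_nonneg _).trans (hx 0)
    rw [← (hs _).tsum_eq]
    simp_rw [← (hs _).tsum_eq]
    refine tendsto_tsum_of_dominated_convergence
      (bound := fun k => ‖a‖ * r * (‖ξ k‖ ^ 2 + ‖η k‖ ^ 2)) ((hξ.add hη).mul_left _)
      (fun k => ?_) (Eventually.of_forall fun n k => ?_)
    · have := hy (star (a : H →L[ℂ] H) (η k)) (ξ k)
      simp only [ContinuousLinearMap.star_eq_adjoint, ContinuousLinearMap.adjoint_inner_left]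
        at this
      exact this
    · have h1 : ‖((a * x n : M) : H →L[ℂ] H) (ξ k)‖ ≤ ‖a‖ * r * ‖ξ k‖ := by
        refine ((a * x n : M) : H →L[ℂ] H).le_of_opNorm_le ?_ _
        exact (norm_mul_le a (x n)).trans (mul_le_mul_of_nonneg_left (hx n) (norm_nonneg _))
      have h2 : ‖η k‖ * ‖ξ k‖ ≤ ‖ξ k‖ ^ 2 + ‖η k‖ ^ 2 := by
        nlinarith [sq_nonneg (‖η k‖ - ‖ξ k‖), sq_nonneg ‖ξ k‖, sq_nonneg ‖η k‖]
      calc _ ≤ ‖η k‖ * ‖((a * x n : M) : H →L[ℂ] H) (ξ k)‖ := norm_inner_le_norm _ _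
        _ ≤ ‖η k‖ * (‖a‖ * r * ‖ξ k‖) := by gcongr
        _ = ‖a‖ * r * (‖η k‖ * ‖ξ k‖) := by ring
        _ ≤ _ := mul_le_mul_of_nonneg_left h2 (mul_nonneg (norm_nonneg _) hr)
  · have : (0 : H →L[ℂ] H) ≤ y - (z : H →L[ℂ] H) := by
      refine ContinuousLinearMap.nonneg_of_tendsto_inner (hyperfilter ℕ)
        (x := fun n => (x n : H →L[ℂ] H) - (z : H →L[ℂ] H)) (fun ζ η => ?_) ?_
      · simpa [inner_sub_right] using (hy ζ η).sub_const _
      · filter_upwards [hz] with n hn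
        exact sub_nonneg.2 hn
    exact sub_nonneg.1 this
  · have : (0 : H →L[ℂ] H) ≤ (z : H →L[ℂ] H) - y := by
      refine ContinuousLinearMap.nonneg_of_tendsto_inner (hyperfilter ℕ)
        (x := fun n => (z : H →L[ℂ] H) - (x n : H →L[ℂ] H)) (fun ζ η => ?_) ?_
      · simpa [inner_sub_right] using (hy ζ η).const_sub _
      · filter_upwards [hz] with n hn
        exact sub_nonneg.2 hn
    exact sub_nonneg.1 this

end BallCompact

/-! ### The commutation theorem: `λ(A)'` consists of right multiplications. -/

namespace TraceRep

open Filter Topology Metric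

variable {A : Type*} [CStarAlgebra A] [PartialOrder A] {τ : A →ₚ[ℂ] ℂ}

theorem re_mono {x y : A} (h : x ≤ y) : (τ x).re ≤ (τ y).re :=
  (Complex.le_def.1 (OrderHomClass.mono τ h)).1

theorem map_real_smul' (r : ℝ) (x : A) : τ (r • x) = r * τ x := by
  rw [← Complex.coe_smul, map_smul, smul_eq_mul]

variable [StarOrderedRing A]

theorem ext_toL2 {F : Type*} [TopologicalSpace F] [T2Space F] {f g : L2 τ → F}
    (hf : Continuous f) (hg : Continuous g) (h : ∀ x, f (toL2 τ x) = g (toL2 τ x)) (v : L2 τ) :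
    f v = g v :=
  congrFun ((denseRange_toL2 τ).equalizer hf hg (funext h)) v

theorem eq_of_inner_toL2 {ζ η : L2 τ} (h : ∀ a, ⟪toL2 τ a, ζ⟫_ℂ = ⟪toL2 τ a, η⟫_ℂ) : ζ = η :=
  ext_inner_left ℂ (ext_toL2 (by fun_prop) (by fun_prop) h)

theorem norm_sq_toL2 (x : A) : ‖toL2 τ x‖ ^ 2 = (τ (star x * x)).re := by
  rw [← inner_toL2, inner_self_eq_norm_sq_to_K]
  norm_cast

theorem norm_toL2_le (x : A) : ‖toL2 τ x‖ ≤ ‖x‖ * ‖toL2 τ (1 : A)‖ := by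
  have h := lam_toL2 τ x 1
  rw [mul_one] at h
  rw [← h]
  exact (lam τ x).le_of_opNorm_le (NonUnitalStarAlgHom.norm_apply_le (lam τ) x) _

/-- An `L²`-convergent sequence from the ball has a `τ`-weak limit `y` in the ball. The `L²` limit
and `y` have the same inner products with the dense subspace `A`, hence they agree. -/
theorem isClosed_image_toL2 (hc : IsBallCompact τ) (r : ℝ) :
    IsClosed (toL2 τ '' closedBall 0 r) := by
  rw [← isSeqClosed_iff_isClosed]
  intro u ζ hu hζ
  choose x hx hxu using hu
  obtain ⟨y, hy, hlim, -⟩ := hc r x (fun n => by simpa using hx n)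
  refine ⟨y, by simpa using hy, eq_of_inner_toL2 fun a => ?_⟩
  rw [inner_toL2]
  refine tendsto_nhds_unique (hlim (star a)) ?_
  have h1 : Tendsto (fun n => ⟪toL2 τ a, u n⟫_ℂ) atTop (𝓝 ⟪toL2 τ a, ζ⟫_ℂ) :=
    tendsto_const_nhds.inner hζ
  refine (h1.mono_left ?_).congr fun n => ?_
  · rw [← Nat.cofinite_eq_atTop]
    exact hyperfilter_le_cofinite
  · rw [← hxu, inner_toL2]

theorem convex_image_toL2 (r : ℝ) : Convex ℝ (toL2 τ '' closedBall 0 r) :=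
  (convex_closedBall (0 : A) r).is_linear_image
    ((toL2 τ).restrictScalars ℝ).isLinear

/-- An approximate polar decomposition `a = |a^*| u`: the factors `c`, `b` replace `|a^*|^{1/2}`
and `|a^*|^{1/2} u`, and `x` replaces `u`. -/
theorem exists_approx_polar (hτ : ∀ x y : A, τ (x * y) = τ (y * x)) (a : A) {ε : ℝ}
    (hε : 0 < ε) :
    ∃ (x b c : A) (t : ℝ), ‖x‖ ≤ 1 ∧ a = c * b ∧ (τ (star b * b)).re ≤ t ∧
      (τ (star c * c)).re ≤ t ∧ t ≤ (τ (star a * x)).re + ε * (τ 1).re := by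
  -- The shift by `ε²` makes `a a^*` invertible. With `m = p^{1/4}` and `n = m⁻¹` the witnesses are
  -- `x = n² a`, `b = n a`, `c = m`, `t = τ(m²)`.
  set p : A := a * star a + (ε ^ 2) • (1 : A) with hp
  have hpos : IsStrictlyPositive p := by
    refine IsStrictlyPositive.nonneg_add (mul_star_self_nonneg a) ?_
    exact IsStrictlyPositive.smul (by positivity) isStrictlyPositive_one
  have hk0 : 0 ≤ CFC.sqrt p := CFC.sqrt_nonneg _
  set m : A := CFC.sqrt (CFC.sqrt p) with hm
  have hm0 : 0 ≤ m := CFC.sqrt_nonneg _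
  have hmm : m * m = CFC.sqrt p := CFC.sqrt_mul_sqrt_self _ hk0
  have hm4 : m * m * (m * m) = p := by rw [hmm]; exact CFC.sqrt_mul_sqrt_self _ hpos.nonneg
  have hmu : IsUnit m := by
    have h : IsUnit (m * m * (m * m)) := hm4 ▸ hpos.isUnit
    rw [(Commute.refl (m * m)).isUnit_mul_iff, (Commute.refl m).isUnit_mul_iff] at h
    exact h.1.1
  obtain ⟨u, hu⟩ := hmu
  have hms : star m = m := (IsSelfAdjoint.of_nonneg hm0).star_eq
  set n : A := ((u⁻¹ : Aˣ) : A) with hn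
  have hnm : n * m = 1 := by rw [hn, ← hu]; exact u.inv_mul
  have hmn : m * n = 1 := by rw [hn, ← hu]; exact u.mul_inv
  have hns : star n = n := by
    calc star n = star n * (m * n) := by rw [hmn, mul_one]
      _ = star (m * n) * n := by rw [← mul_assoc, star_mul, hms]
      _ = n := by rw [hmn, star_one, one_mul]
  have haa : a * star a = m * m * (m * m) - (ε ^ 2) • (1 : A) := by rw [hm4, hp]; abel
  have hnaa : n * n * (a * star a) = m * m - (ε ^ 2) • (n * n) := by
    rw [haa, mul_sub, mul_smul_comm, mul_one]
    congr 1
    calc n * n * (m * m * (m * m)) = n * (n * m) * m * (m * m) := by noncomm_ring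
      _ = m * m := by rw [hnm, mul_one, hnm, one_mul]
  have hxx : (n * n * a) * star (n * n * a) = 1 - (ε ^ 2) • (n * n * (n * n)) := by
    calc (n * n * a) * star (n * n * a) = n * n * (a * star a) * (n * n) := by
          simp only [star_mul, hns]; noncomm_ring
      _ = m * (m * n) * n - (ε ^ 2) • (n * n * (n * n)) := by
          rw [hnaa, sub_mul, smul_mul_assoc]; noncomm_ring
      _ = _ := by rw [hmn, mul_one, hmn]
  have hn4 : 0 ≤ n * n * (n * n) := by
    have := star_mul_self_nonneg (n * n)
    rwa [star_mul, hns] at this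
  have hn2 : 0 ≤ n * n := by
    have := star_mul_self_nonneg n
    rwa [hns] at this
  have hx1 : ‖n * n * a‖ ≤ 1 := by
    have h1 : ‖(n * n * a) * star (n * n * a)‖ ≤ 1 := by
      rw [CStarAlgebra.norm_le_one_iff_of_nonneg _ (mul_star_self_nonneg _), hxx]
      exact sub_le_self _ (smul_nonneg (by positivity) hn4)
    rw [CStarRing.norm_self_mul_star] at h1
    nlinarith [norm_nonneg (n * n * a)]
  -- The square of `ε n²` is `1 - x x^* ≤ 1`. This controls the defect `t - τ(a^* x) = ε τ(ε n²)`.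
  have hen : ε • (n * n) ≤ 1 := by
    have h0 : 0 ≤ ε • (n * n) := smul_nonneg hε.le hn2
    have hs : star (ε • (n * n)) = ε • (n * n) := (IsSelfAdjoint.of_nonneg h0).star_eq
    have h2 : star (ε • (n * n)) * (ε • (n * n)) = (ε ^ 2) • (n * n * (n * n)) := by
      rw [hs, smul_mul_smul_comm, sq]
    rw [← CStarAlgebra.norm_le_one_iff_of_nonneg _ h0]
    have h1 : ‖star (ε • (n * n)) * (ε • (n * n))‖ ≤ 1 := by
      rw [CStarAlgebra.norm_le_one_iff_of_nonneg _ (star_mul_self_nonneg _), h2, ← sub_nonneg,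
        ← hxx]
      exact mul_star_self_nonneg _
    rw [CStarRing.norm_star_mul_self] at h1
    nlinarith [norm_nonneg (ε • (n * n))]
  have htr : τ (star a * (n * n * a)) = τ (m * m) - ε * τ (ε • (n * n)) := by
    rw [hτ, mul_assoc, hnaa, map_sub, map_real_smul', map_real_smul']
    push_cast; ring
  have hA : 0 ≤ (τ (ε • (n * n))).re := by
    simpa using re_mono (τ := τ) (smul_nonneg hε.le hn2)
  refine ⟨n * n * a, n * a, m, (τ (m * m)).re, hx1, ?_, ?_, ?_, ?_⟩
  · rw [← mul_assoc, hmn, one_mul]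
  · have : star (n * a) * (n * a) = star a * (n * n * a) := by
      rw [star_mul, hns]; noncomm_ring
    rw [this, htr, Complex.sub_re, Complex.re_ofReal_mul]
    nlinarith
  · rw [hms]
  · rw [htr, Complex.sub_re, Complex.re_ofReal_mul]
    have := re_mono (τ := τ) hen
    nlinarith

/-- Separation of a point of `L²(A)` from a bounded closed convex set by a vector of `A`. -/
theorem mem_of_forall_re_inner_le {K : Set (L2 τ)} (hK : IsClosed K) (hconv : Convex ℝ K)
    {B : ℝ} (hB : ∀ y ∈ K, ‖y‖ ≤ B) {η : L2 τ}
    (h : ∀ a : A, ∀ ε > 0, ∃ y ∈ K, (⟪toL2 τ a, η - y⟫_ℂ).re ≤ ε) : η ∈ K := by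
  let _ : InnerProductSpace ℝ (L2 τ) := InnerProductSpace.complexToReal
  obtain ⟨y₀, hy₀, -⟩ := h 0 1 one_pos
  obtain ⟨v, hv, hmin⟩ := exists_norm_eq_iInf_of_complete_convex ⟨y₀, hy₀⟩ hK.isComplete hconv η
  rw [norm_eq_iInf_iff_real_inner_le_zero hconv hv] at hmin
  -- As `v` is the point of `K` nearest to `η`, `‖η - v‖² ≤ Re ⟨η - v, η - y⟩` for all `y` in `K`.
  -- Replacing `η - v` by a nearby `a` costs at most `δ / 2`, since `D` bounds `‖η - y‖` uniformly
  -- on `K`.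
  have hle : ∀ δ > 0, ‖η - v‖ ^ 2 ≤ δ := by
    intro δ hδ
    have hB0 : 0 ≤ B := (norm_nonneg _).trans (hB v hv)
    set D := ‖η‖ + B + 1 with hD
    have hD0 : 0 < D := by positivity
    obtain ⟨a, ha⟩ := (denseRange_toL2 τ).exists_dist_lt (η - v)
      (show 0 < δ / 2 / D by positivity)
    obtain ⟨y, hy, hay⟩ := h a (δ / 2) (by positivity)
    have h1 : ⟪η - v, y - v⟫_ℝ ≤ 0 := hmin y hy
    have h2 : (⟪η - v, η - y⟫_ℂ).re = ‖η - v‖ ^ 2 - ⟪η - v, y - v⟫_ℝ := by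
      have : ⟪η - v, η - y⟫_ℝ = ⟪η - v, η - v⟫_ℝ - ⟪η - v, y - v⟫_ℝ := by
        rw [← inner_sub_right]; congr 1; abel
      rw [real_inner_self_eq_norm_sq] at this
      exact this
    have h3 : (⟪η - v, η - y⟫_ℂ).re
        = (⟪η - v - toL2 τ a, η - y⟫_ℂ).re + (⟪toL2 τ a, η - y⟫_ℂ).re := by
      rw [inner_sub_left (η - v), Complex.sub_re]; ring
    have h4 : (⟪η - v - toL2 τ a, η - y⟫_ℂ).re ≤ δ / 2 := by
      refine (Complex.re_le_norm _).trans ((norm_inner_le_norm _ _).trans ?_)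
      rw [dist_eq_norm] at ha
      have h5 : ‖η - y‖ ≤ D := by
        have := norm_sub_le η y
        have := hB y hy
        linarith
      calc _ ≤ δ / 2 / D * D := by gcongr
        _ = δ / 2 := by field_simp
    linarith
  have h0 : ‖η - v‖ ^ 2 ≤ 0 := le_of_forall_pos_le_add fun δ hδ => by simpa using hle δ hδ
  have : η - v = 0 := by
    rw [← norm_eq_zero]
    exact pow_eq_zero_iff (two_ne_zero) |>.1 (le_antisymm h0 (sq_nonneg _))
  rwa [sub_eq_zero.1 this]

theorem lamCommutant_apply {T : L2 τ →L[ℂ] L2 τ} (hT : T ∈ lamCommutant τ) (x : A) (v : L2 τ) :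
    T (lam τ x v) = lam τ x (T v) :=
  (DFunLike.congr_fun (hT (lam τ x) ⟨x, rfl⟩) v).symm

theorem apply_toL2_of_mem_lamCommutant {T : L2 τ →L[ℂ] L2 τ} (hT : T ∈ lamCommutant τ) (y : A) :
    T (toL2 τ y) = lam τ y (T (toL2 τ 1)) := by
  rw [← lamCommutant_apply hT, lam_toL2, mul_one]

/-- The commutation theorem: every operator in `λ(A)'` is a right multiplication. -/
theorem exists_right_mul_of_mem_lamCommutant (hτ : ∀ x y : A, τ (x * y) = τ (y * x))
    (hc : IsBallCompact τ) {T : L2 τ →L[ℂ] L2 τ} (hT : T ∈ lamCommutant τ) :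
    ∃ z : A, ∀ y, T (toL2 τ y) = toL2 τ (y * z) := by
  -- Since `T y = λ(y) T 1`, it is enough that the vector `T 1` comes from `A`. Separation reduces
  -- this to bounding `Re ⟨a, T 1⟩` by the values of `⟨a, ·⟩` on the ball of radius `‖T‖`.
  suffices h : T (toL2 τ 1) ∈ toL2 τ '' closedBall 0 ‖T‖ by
    obtain ⟨z, -, hz⟩ := h
    refine ⟨z, fun y => ?_⟩
    rw [apply_toL2_of_mem_lamCommutant hT, ← hz, lam_toL2]
  refine mem_of_forall_re_inner_le (B := ‖T‖ * ‖toL2 τ (1 : A)‖) (isClosed_image_toL2 hc _)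
    (convex_image_toL2 _) ?_ fun a ε hε => ?_
  · rintro _ ⟨x, hx, rfl⟩
    refine (norm_toL2_le x).trans ?_
    gcongr
    simpa using hx
  have ht0 : 0 ≤ (τ 1).re := by simpa using re_mono (τ := τ) (zero_le_one' A)
  obtain ⟨x, b, c, t, hx, rfl, hb, hc', hax⟩ := exists_approx_polar hτ a
    (show 0 < ε / (‖T‖ * (τ 1).re + 1) by positivity)
  refine ⟨toL2 τ ((‖T‖ : ℂ) • x), ⟨_, ?_, rfl⟩, ?_⟩
  · rw [mem_closedBall_zero_iff, norm_smul, Complex.norm_real, norm_norm]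
    exact mul_le_of_le_one_right (norm_nonneg _) hx
  -- Moving `c` across the inner product and through `T` splits `a = c b` into two vectors of
  -- squared norm at most `t`. By traciality `c^*` and `c` have the same `L²` norm.
  have h1 : ⟪toL2 τ (c * b), T (toL2 τ 1)⟫_ℂ = ⟪toL2 τ b, T (toL2 τ (star c))⟫_ℂ := by
    rw [apply_toL2_of_mem_lamCommutant hT (star c), map_star, ContinuousLinearMap.star_eq_adjoint,
      ContinuousLinearMap.adjoint_inner_right, lam_toL2]
  have hcs : ‖toL2 τ (star c)‖ ^ 2 ≤ t := by
    rw [norm_sq_toL2, star_star, hτ]; exact hc'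
  have hbs : ‖toL2 τ b‖ ^ 2 ≤ t := by rw [norm_sq_toL2]; exact hb
  have h2 : (⟪toL2 τ (c * b), T (toL2 τ 1)⟫_ℂ).re ≤ ‖T‖ * t := by
    rw [h1]
    refine (Complex.re_le_norm _).trans ((norm_inner_le_norm _ _).trans ?_)
    calc ‖toL2 τ b‖ * ‖T (toL2 τ (star c))‖ ≤ ‖toL2 τ b‖ * (‖T‖ * ‖toL2 τ (star c)‖) := by
          gcongr; exact T.le_opNorm _
      _ = ‖T‖ * (‖toL2 τ b‖ * ‖toL2 τ (star c)‖) := by ring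
      _ ≤ ‖T‖ * t := by
          gcongr
          nlinarith [sq_nonneg (‖toL2 τ b‖ - ‖toL2 τ (star c)‖)]
  rw [inner_sub_right, Complex.sub_re, inner_toL2, mul_smul_comm, map_smul, smul_eq_mul,
    Complex.re_ofReal_mul]
  have h3 : ‖T‖ * t ≤ ‖T‖ * ((τ (star (c * b) * x)).re + ε / (‖T‖ * (τ 1).re + 1) * (τ 1).re) := by
    gcongr
  have h4 : ‖T‖ * (ε / (‖T‖ * (τ 1).re + 1) * (τ 1).re) ≤ ε := by
    have : 0 < ‖T‖ * (τ 1).re + 1 := by positivity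
    calc _ = ε * ((‖T‖ * (τ 1).re) / (‖T‖ * (τ 1).re + 1)) := by ring
      _ ≤ ε * 1 := by
          gcongr
          rw [div_le_one this]; linarith
      _ = ε := mul_one _
  linarith

theorem conjJ_eq_lam (hτ : ∀ x y : A, τ (x * y) = τ (y * x)) {T : L2 τ →L[ℂ] L2 τ} {z : A}
    (hz : ∀ y, T (toL2 τ y) = toL2 τ (y * z)) : conjJ hτ T = lam τ (star z) := by
  ext v
  refine ext_toL2 (by fun_prop) (by fun_prop) (fun x => ?_) v
  change J hτ (T (J hτ (toL2 τ x))) = _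
  rw [J_toL2, hz, J_toL2, lam_toL2, star_mul, star_star]

end TraceRep

/-! ### Antiautomorphisms as order isomorphisms. -/

namespace InvolutiveStarAntiaut

variable {A : Type*} [CStarAlgebra A] (α : InvolutiveStarAntiaut A)

theorem map_one' : α 1 = 1 := by
  have h := α.map_mul 1 (α 1)
  rw [one_mul, α.involutive, one_mul] at h
  exact h.symm

variable [PartialOrder A] [StarOrderedRing A]

theorem map_nonneg {x : A} (hx : 0 ≤ x) : 0 ≤ α x := by
  obtain ⟨s, rfl⟩ := CStarAlgebra.nonneg_iff_eq_star_mul_self.1 hx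
  rw [α.map_mul, α.map_star]
  exact mul_star_self_nonneg _

theorem mono {x y : A} (h : x ≤ y) : α x ≤ α y := by
  rw [← sub_nonneg, ← map_sub]
  exact α.map_nonneg (sub_nonneg.2 h)

end InvolutiveStarAntiaut

/-! ### The operator monotone truncation `x ↦ 1 - (1 + x)⁻¹`. -/

section ResolventFunction

open NNReal

variable {A : Type*} [CStarAlgebra A] [PartialOrder A] [StarOrderedRing A]

theorem cfcₙ_one_sub_one_add_inv_le {s : A} (hs : 0 ≤ s) :
    cfcₙ (fun x : ℝ≥0 => 1 - (1 + x)⁻¹) s ≤ s := by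
  conv_rhs => rw [← cfcₙ_id' ℝ≥0 s]
  refine cfcₙ_mono (fun x _ => ?_) ?_ ?_
  · have h : (1 + x)⁻¹ * (1 + x) = 1 := inv_mul_cancel₀ (by positivity)
    rw [tsub_le_iff_right]
    have h1 : (1 + x)⁻¹ ≤ 1 := inv_le_one_of_one_le₀ (by simp)
    calc (1 : ℝ≥0) = (1 + x)⁻¹ * (1 + x) := h.symm
      _ = (1 + x)⁻¹ + (1 + x)⁻¹ * x := by rw [mul_add, mul_one]
      _ ≤ (1 + x)⁻¹ + 1 * x := by gcongr
      _ = x + (1 + x)⁻¹ := by ring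
  · fun_prop (disch := intro _ _; positivity)
  · fun_prop

theorem half_smul_le_cfcₙ_one_sub_one_add_inv {s : A} (hs : 0 ≤ s) (hs1 : s ≤ 1) :
    (2⁻¹ : ℝ≥0) • s ≤ cfcₙ (fun x : ℝ≥0 => 1 - (1 + x)⁻¹) s := by
  conv_lhs => rw [← cfcₙ_id' ℝ≥0 s]
  rw [← cfcₙ_smul _ _ s]
  refine cfcₙ_mono (fun x hx => ?_) ?_ ?_
  · have hx1 : x ≤ 1 :=
      (CStarAlgebra.le_nnnorm_of_mem_quasispectrum hx).trans
        ((CStarAlgebra.nnnorm_le_one_iff_of_nonneg s hs).2 hs1)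
    have h : (1 + x)⁻¹ * (1 + x) = 1 := inv_mul_cancel₀ (by positivity)
    refine le_tsub_of_add_le_right ?_
    have h1 : 2⁻¹ ≤ (1 + x)⁻¹ := by
      refine inv_anti₀ (by positivity) ?_
      calc 1 + x ≤ 1 + 1 := by gcongr
        _ = 2 := by norm_num
    calc (2⁻¹ : ℝ≥0) • x + (1 + x)⁻¹ ≤ (1 + x)⁻¹ * x + (1 + x)⁻¹ := by
          rw [smul_eq_mul]; gcongr
      _ = (1 + x)⁻¹ * (1 + x) := by ring
      _ = 1 := h
  · fun_prop
  · fun_prop (disch := intro _ _; positivity)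

end ResolventFunction

/-! ### Invariance of the trace under `α`. -/

namespace TraceRep

open Filter Topology Metric

variable {A : Type*} [CStarAlgebra A]

/-- The set of unitary conjugates of `x`. -/
def unitaryOrbit (x : A) : Set A := {y | ∃ u ∈ unitary A, y = u * x * star u}

theorem norm_le_of_mem_convexHull_unitaryOrbit {x y : A}
    (hy : y ∈ convexHull ℝ (unitaryOrbit x)) : ‖y‖ ≤ ‖x‖ := by
  have : convexHull ℝ (unitaryOrbit x) ⊆ closedBall 0 ‖x‖ := by
    refine convexHull_min ?_ (convex_closedBall _ _)
    rintro _ ⟨u, hu, rfl⟩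
    rw [mem_closedBall_zero_iff]
    have := CStarRing.norm_mul_mem_unitary (u * x) (Unitary.star_mem hu)
    rw [this, CStarRing.norm_mem_unitary_mul x hu]
  simpa using this hy

theorem map_of_mem_convexHull_unitaryOrbit {φ : A →ₗ[ℂ] ℂ}
    (hφ : ∀ x y : A, φ (x * y) = φ (y * x)) {x y : A}
    (hy : y ∈ convexHull ℝ (unitaryOrbit x)) : φ y = φ x := by
  have : convexHull ℝ (unitaryOrbit x) ⊆ (φ.restrictScalars ℝ) ⁻¹' {φ x} := by
    refine convexHull_min ?_ ((convex_singleton (φ x)).linear_preimage (φ.restrictScalars ℝ))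
    rintro _ ⟨u, hu, rfl⟩
    change φ (u * x * star u) = φ x
    rw [hφ, ← mul_assoc, Unitary.star_mul_self_of_mem hu, one_mul]
  exact this hy

theorem unitary_conj_mem_convexHull_unitaryOrbit {x y u : A} (hu : u ∈ unitary A)
    (hy : y ∈ convexHull ℝ (unitaryOrbit x)) :
    u * y * star u ∈ convexHull ℝ (unitaryOrbit x) := by
  let L : A →ₗ[ℝ] A := (LinearMap.mulRight ℝ (star u)).comp (LinearMap.mulLeft ℝ u)
  have : convexHull ℝ (unitaryOrbit x) ⊆ L ⁻¹' convexHull ℝ (unitaryOrbit x) := by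
    refine convexHull_min ?_ ((convex_convexHull ℝ _).linear_preimage L)
    rintro _ ⟨v, hv, rfl⟩
    refine subset_convexHull ℝ _ ⟨u * v, mul_mem hu hv, ?_⟩
    simp [L, mul_assoc]
  exact this hy

variable [PartialOrder A] [StarOrderedRing A] {τ : A →ₚ[ℂ] ℂ}

theorem eq_zero_of_re_nonpos (hf : ∀ x : A, τ (star x * x) = 0 → x = 0) {d : A} (hd : 0 ≤ d)
    (h : (τ d).re ≤ 0) : d = 0 := by
  have h0 : 0 ≤ τ d := τ.map_nonneg hd
  obtain ⟨s, rfl⟩ := CStarAlgebra.nonneg_iff_eq_star_mul_self.1 hd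
  rw [hf s (le_antisymm (Complex.le_def.2 ⟨h, (Complex.le_def.1 h0).2.symm⟩) h0), mul_zero]

/-- `τ ∘ α` is absolutely continuous with respect to `τ` on positive contractions. -/
theorem exists_comp_lt (hf : ∀ x : A, τ (star x * x) = 0 → x = 0) (hc : IsBallCompact τ)
    (α : InvolutiveStarAntiaut A) {δ : ℝ} (hδ : 0 < δ) :
    ∃ ε > 0, ∀ a : A, 0 ≤ a → a ≤ 1 → (τ a).re ≤ ε → (τ (α a)).re < δ := by
  by_contra! hcon
  -- A Borel–Cantelli argument. The tail sums of the `a n` have small trace but may be unbounded in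
  -- norm, so the operator monotone `f` truncates them. The weak limits `b N` decrease, with `τ(b N)
  -- → 0` while `τ(α(b N)) ≥ δ / 2`.
  choose a ha0 ha1 haτ haδ using fun n : ℕ => hcon ((1 / 2) ^ n) (by positivity)
  set f : A → A := cfcₙ (fun x : NNReal => 1 - (1 + x)⁻¹) with hfdef
  have hf0 : ∀ s, 0 ≤ f s := fun s => by rw [hfdef]; exact cfcₙ_nonneg_of_predicate
  have hf1 : ∀ s, ‖f s‖ ≤ 1 := fun s => (norm_cfcₙ_one_sub_one_add_inv_lt_one s).le
  let s : ℕ → ℕ → A := fun N n => ∑ k ∈ Finset.range (n + 1), a (N + k)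
  have hs0 : ∀ N n, 0 ≤ s N n := fun N n => Finset.sum_nonneg fun k _ => ha0 _
  have hsτ : ∀ N n, (τ (s N n)).re ≤ 2 * (1 / 2) ^ N := by
    intro N n
    rw [map_sum, Complex.re_sum]
    calc _ ≤ ∑ k ∈ Finset.range (n + 1), (1 / 2 : ℝ) ^ N * (1 / 2) ^ k :=
          Finset.sum_le_sum fun k _ => (haτ _).trans_eq (pow_add _ _ _)
      _ = (1 / 2) ^ N * ∑ k ∈ Finset.range (n + 1), (1 / 2 : ℝ) ^ k := by rw [Finset.mul_sum]
      _ ≤ (1 / 2) ^ N * 2 := by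
          gcongr
          exact sum_geometric_two_le _
      _ = _ := mul_comm _ _
  have hfs : ∀ {N n N' n'}, s N n ≤ s N' n' → f (s N n) ≤ f (s N' n') := fun h =>
    CFC.monotoneOn_one_sub_one_add_inv (hs0 _ _) (hs0 _ _) h
  have hsmono : ∀ N, Monotone (s N) := fun N => monotone_nat_of_le_succ fun n => by
    simp only [s]
    rw [Finset.sum_range_succ _ (n + 1)]
    exact le_add_of_nonneg_right (ha0 _)
  -- Both sums end with the same term; the right one has the additional first term `a N`. Hence `b`
  -- is decreasing.
  have hsN : ∀ N n, s (N + 1) n ≤ s N (n + 1) := fun N n => by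
    simp only [s]
    rw [Finset.sum_range_succ' _ (n + 1)]
    refine le_add_of_le_of_nonneg (le_of_eq (Finset.sum_congr rfl fun k _ => ?_)) (ha0 _)
    congr 1; ring
  have hatTop : ∀ {p : ℕ → Prop}, (∀ᶠ n in atTop, p n) →
      ∀ᶠ n in (hyperfilter ℕ : Filter ℕ), p n := fun h =>
    hyperfilter_le_cofinite (Nat.cofinite_eq_atTop ▸ h)
  choose b hb1 hbτ hblow hbup using fun N => hc 1 (fun n => f (s N n)) (fun n => hf1 _)
  have hle : ∀ N n, f (s N n) ≤ b N := fun N n =>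
    hblow N _ (hatTop ((eventually_ge_atTop n).mono fun m hm => hfs (hsmono N hm)))
  have hb0 : ∀ N, 0 ≤ b N := fun N => (hf0 _).trans (hle N 0)
  have hbanti : Antitone b := antitone_nat_of_succ_le fun N =>
    hbup (N + 1) _ (Eventually.of_forall fun n => (hfs (hsN N n)).trans (hle N (n + 1)))
  have hbre : ∀ N, (τ (b N)).re ≤ 2 * (1 / 2) ^ N := by
    intro N
    have h := (Complex.continuous_re.tendsto _).comp (hbτ N 1)
    simp only [one_mul] at h
    exact le_of_tendsto h (Eventually.of_forall fun n =>
      (re_mono (cfcₙ_one_sub_one_add_inv_le (hs0 N n))).trans (hsτ N n))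
  have hbα : ∀ N, δ / 2 ≤ (τ (α (b N))).re := by
    intro N
    have h1 : (2⁻¹ : ℝ) • a N ≤ b N := by
      refine le_trans ?_ (hle N 0)
      have : s N 0 = a N := by simp [s]
      rw [this]
      exact half_smul_le_cfcₙ_one_sub_one_add_inv (ha0 N) (ha1 N)
    have h2 := re_mono (τ := τ) (α.mono h1)
    rw [← Complex.coe_smul, map_smul, map_smul, smul_eq_mul, Complex.re_ofReal_mul] at h2
    have := haδ N
    linarith
  have hαb : ∀ N, ‖α (b N)‖ ≤ 1 := by
    intro N
    rw [CStarAlgebra.norm_le_one_iff_of_nonneg _ (α.map_nonneg (hb0 N)), ← α.map_one']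
    exact α.mono ((CStarAlgebra.norm_le_one_iff_of_nonneg _ (hb0 N)).1 (hb1 N))
  -- The limit `d` lies below every `α(b N)`, so `α d ≤ b N` for all `N`, and faithfulness forces `d
  -- = 0`. This contradicts `τ(d) ≥ δ / 2`.
  obtain ⟨d, -, hdτ, hdlow, hdup⟩ := hc 1 (fun N => α (b N)) hαb
  have hd0 : 0 ≤ d := hdlow 0 (Eventually.of_forall fun N => α.map_nonneg (hb0 N))
  have hdb : ∀ N, α d ≤ b N := by
    intro N
    rw [← α.involutive (b N)]
    exact α.mono (hdup _ (hatTop ((eventually_ge_atTop N).mono fun m hm => α.mono (hbanti hm))))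
  have hαd : α d = 0 := by
    refine eq_zero_of_re_nonpos hf (α.map_nonneg hd0) ?_
    have h : Tendsto (fun N : ℕ => 2 * (1 / 2 : ℝ) ^ N) atTop (𝓝 (2 * 0)) :=
      (tendsto_pow_atTop_nhds_zero_of_lt_one (by norm_num) (by norm_num)).const_mul 2
    rw [mul_zero] at h
    exact ge_of_tendsto h (Eventually.of_forall fun N => (re_mono (hdb N)).trans (hbre N))
  have hd : d = 0 := by rw [← α.involutive d, hαd, map_zero]
  have h := (Complex.continuous_re.tendsto _).comp (hdτ 1)
  rw [hd, mul_zero, map_zero, Complex.zero_re] at h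
  have : δ / 2 ≤ 0 := ge_of_tendsto h (Eventually.of_forall fun N => by simpa using hbα N)
  linarith

theorem toL2_injective (hf : ∀ x : A, τ (star x * x) = 0 → x = 0) :
    Function.Injective (toL2 τ) := by
  rw [injective_iff_map_eq_zero]
  intro x hx
  apply hf
  rw [← inner_toL2, hx, inner_zero_left]

/-- The extension is `λ(u) J λ(u) J`, because `J λ(u) J` is right multiplication by `u^*`. -/
theorem exists_unitary_conj_extension (hτ : ∀ x y : A, τ (x * y) = τ (y * x)) {u : A}
    (hu : u ∈ unitary A) : ∃ W : L2 τ →L[ℂ] L2 τ, (∀ v, ‖W v‖ = ‖v‖) ∧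
      ∀ y, W (toL2 τ y) = toL2 τ (u * y * star u) := by
  have hW : ∀ y, (lam τ u * conjJ hτ (lam τ u)) (toL2 τ y) = toL2 τ (u * y * star u) := by
    intro y
    change lam τ u (J hτ (lam τ u (J hτ (toL2 τ y)))) = _
    rw [J_toL2, lam_toL2, J_toL2, lam_toL2, star_mul, star_star, mul_assoc]
  refine ⟨lam τ u * conjJ hτ (lam τ u), fun v => ?_, hW⟩
  refine ext_toL2 (ContinuousLinearMap.continuous _).norm continuous_norm (fun y => ?_) v
  rw [hW, ← sq_eq_sq₀ (norm_nonneg _) (norm_nonneg _), norm_sq_toL2, norm_sq_toL2]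
  congr 1
  have h : star (u * y * star u) * (u * y * star u) = u * (star y * y) * star u := by
    calc _ = u * star y * (star u * u) * y * star u := by simp [mul_assoc]
      _ = _ := by rw [Unitary.star_mul_self_of_mem hu]; simp [mul_assoc]
  rw [h, hτ, ← mul_assoc, Unitary.star_mul_self_of_mem hu, one_mul]

/-- In a factor, `τ(x) 1` is the limit in `L²` of convex combinations of unitary conjugates
of `x`. -/
theorem exists_mem_convexHull_norm_lt (hτ : ∀ x y : A, τ (x * y) = τ (y * x)) (h1 : τ 1 = 1)
    (hf : ∀ x : A, τ (star x * x) = 0 → x = 0) (hc : IsBallCompact τ)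
    (hz : ∀ z : A, (∀ x, z * x = x * z) → ∃ c : ℂ, z = c • (1 : A)) (x : A) {ε : ℝ}
    (hε : 0 < ε) :
    ∃ y ∈ convexHull ℝ (unitaryOrbit x), ‖toL2 τ (y - τ x • (1 : A))‖ < ε := by
  let _ : InnerProductSpace ℝ (L2 τ) := InnerProductSpace.complexToReal
  set K₀ : Set (L2 τ) := toL2 τ '' convexHull ℝ (unitaryOrbit x) with hK₀
  have hxK : toL2 τ x ∈ K₀ :=
    ⟨x, subset_convexHull ℝ _ ⟨1, one_mem _, by simp⟩, rfl⟩
  have hconv : Convex ℝ K₀ :=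
    (convex_convexHull ℝ _).is_linear_image ((toL2 τ).restrictScalars ℝ).isLinear
  -- The vector of least norm in the closed hull is unique, hence fixed by all unitary conjugations.
  -- It comes from some `z` in `A`, which is central because unitaries span `A`; the trace then
  -- identifies the scalar.
  obtain ⟨ζ, hζ, hmin⟩ := exists_norm_eq_iInf_of_complete_convex ⟨_, subset_closure hxK⟩
    isClosed_closure.isComplete hconv.closure (0 : L2 τ)
  rw [norm_eq_iInf_iff_real_inner_le_zero hconv.closure hζ] at hmin
  have huniq : ∀ w ∈ closure K₀, ‖w‖ = ‖ζ‖ → w = ζ := by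
    intro w hw hwn
    have h2 := hmin w hw
    rw [zero_sub, inner_neg_left, inner_sub_right, real_inner_self_eq_norm_sq] at h2
    have h3 := norm_sub_sq_real w ζ
    rw [hwn, real_inner_comm] at h3
    have h4 : ‖w - ζ‖ ^ 2 ≤ 0 := by linarith
    have h5 : ‖w - ζ‖ = 0 := pow_eq_zero_iff (two_ne_zero) |>.1 (le_antisymm h4 (sq_nonneg _))
    exact sub_eq_zero.1 (norm_eq_zero.1 h5)
  have hsub : closure K₀ ⊆ toL2 τ '' closedBall 0 ‖x‖ := by
    refine closure_minimal (Set.image_mono fun y hy => ?_) (isClosed_image_toL2 hc _)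
    simpa using norm_le_of_mem_convexHull_unitaryOrbit hy
  obtain ⟨z, -, rfl⟩ := hsub hζ
  have hzu : ∀ u ∈ unitary A, u * z = z * u := by
    intro u hu
    obtain ⟨W, hWn, hW⟩ := exists_unitary_conj_extension hτ hu
    have hWK : W (toL2 τ z) ∈ closure K₀ := by
      refine map_mem_closure W.continuous hζ ?_
      rintro _ ⟨y, hy, rfl⟩
      exact ⟨_, unitary_conj_mem_convexHull_unitaryOrbit hu hy, (hW y).symm⟩
    have h2 := huniq _ hWK (hWn _)
    rw [hW] at h2
    have h3 := toL2_injective hf h2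
    calc u * z = u * z * (star u * u) := by rw [Unitary.star_mul_self_of_mem hu, mul_one]
      _ = z * u := by rw [← mul_assoc, h3]
  obtain ⟨c, hcz⟩ := hz z (by
    intro y
    have hy : y ∈ Submodule.span ℂ (unitary A : Set A) := by
      rw [CStarAlgebra.span_unitary]; trivial
    induction hy using Submodule.span_induction with
    | mem u hu => exact (hzu u hu).symm
    | zero => simp
    | add a b _ _ ha hb => rw [mul_add, add_mul, ha, hb]
    | smul r a _ ha => rw [mul_smul_comm, smul_mul_assoc, ha])
  have htr : τ z = τ x := by
    have hcl : closure K₀ ⊆ {v | ⟪toL2 τ 1, v⟫_ℂ = τ x} := by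
      refine closure_minimal ?_ (isClosed_eq (by fun_prop) continuous_const)
      rintro _ ⟨y, hy, rfl⟩
      change ⟪toL2 τ 1, toL2 τ y⟫_ℂ = τ x
      rw [inner_toL2, star_one, one_mul]
      exact map_of_mem_convexHull_unitaryOrbit (φ := τ.toLinearMap) hτ hy
    have h2 : ⟪toL2 τ 1, toL2 τ z⟫_ℂ = τ x := hcl hζ
    rwa [inner_toL2, star_one, one_mul] at h2
  have hcx : z = τ x • (1 : A) := by
    rw [← htr, hcz, map_smul, h1, smul_eq_mul, mul_one]
  obtain ⟨_, ⟨y, hy, rfl⟩, hd⟩ := Metric.mem_closure_iff.1 hζ ε hε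
  refine ⟨y, hy, ?_⟩
  rwa [map_sub, ← hcx, ← dist_eq_norm, dist_comm]

/-- The trace of a finite factor is invariant under `*`-antiautomorphisms. -/
theorem trace_comp_antiaut (hτ : ∀ x y : A, τ (x * y) = τ (y * x)) (h1 : τ 1 = 1)
    (hf : ∀ x : A, τ (star x * x) = 0 → x = 0) (hc : IsBallCompact τ)
    (hz : ∀ z : A, (∀ x, z * x = x * z) → ∃ c : ℂ, z = c • (1 : A))
    (α : InvolutiveStarAntiaut A) (x : A) : τ (α x) = τ x := by
  set R : ℝ := ‖x‖ + ‖τ x • (1 : A)‖ + 1 with hR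
  have hR0 : 0 < R := by positivity
  have hkey : ∀ δ > 0, ‖τ (α x) - τ x‖ ^ 2 ≤ 0 + R ^ 2 * δ := by
    intro δ hδ
    obtain ⟨ε, hε, hεδ⟩ := exists_comp_lt hf hc α hδ
    obtain ⟨y, hy, hyε⟩ := exists_mem_convexHull_norm_lt hτ h1 hf hc hz x
      (show 0 < R * √ε by positivity)
    set w : A := y - τ x • (1 : A) with hw
    have hwR : ‖w‖ ≤ R := by
      have := norm_sub_le y (τ x • (1 : A))
      have := norm_le_of_mem_convexHull_unitaryOrbit hy
      linarith
    -- Dividing by `R²` makes `w^* w` a contraction, so absolute continuity turns smallness of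
    -- `‖w‖₂` into smallness of `‖α(w)‖₂`. `R` does not depend on `δ`.
    have h2 := hεδ ((R ^ 2)⁻¹ • (star w * w))
      (smul_nonneg (by positivity) (star_mul_self_nonneg w)) (by
        rw [← CStarAlgebra.norm_le_one_iff_of_nonneg _
          (smul_nonneg (by positivity) (star_mul_self_nonneg w)), norm_smul,
          CStarRing.norm_star_mul_self, Real.norm_of_nonneg (by positivity),
          inv_mul_le_iff₀ (by positivity)]
        nlinarith [norm_nonneg w]) (by
        rw [map_real_smul', Complex.re_ofReal_mul, ← norm_sq_toL2, inv_mul_le_iff₀ (by positivity)]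
        calc _ ≤ (R * √ε) ^ 2 := by gcongr
          _ = R ^ 2 * ε := by rw [mul_pow, Real.sq_sqrt hε.le])
    have h3 : τ (α (star w * w)) = τ (star (α w) * α w) := by
      rw [α.map_mul, α.map_star, hτ]
    rw [← Complex.coe_smul, map_smul, map_smul, smul_eq_mul, Complex.re_ofReal_mul, h3,
      ← norm_sq_toL2, inv_mul_lt_iff₀ (by positivity)] at h2
    have h4 : τ (α y) = τ (α x) := by
      refine map_of_mem_convexHull_unitaryOrbit (φ := τ.toLinearMap.comp α.toLinearMap)
        (fun a b => ?_) hy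
      change τ (α (a * b)) = τ (α (b * a))
      rw [α.map_mul, α.map_mul, hτ]
    have h5 : τ (α x) - τ x = ⟪toL2 τ 1, toL2 τ (α w)⟫_ℂ := by
      rw [inner_toL2, star_one, one_mul, hw, map_sub, map_smul, α.map_one', map_sub, map_smul, h1,
        h4, smul_eq_mul, mul_one]
    have h6 : ‖toL2 τ (1 : A)‖ = 1 := by
      have := norm_sq_toL2 (τ := τ) 1
      rw [star_one, one_mul, h1, Complex.one_re] at this
      exact (pow_eq_one_iff_of_nonneg (norm_nonneg _) two_ne_zero).1 this
    have h7 : ‖τ (α x) - τ x‖ ≤ ‖toL2 τ (α w)‖ := by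
      rw [h5]
      refine (norm_inner_le_norm _ _).trans_eq ?_
      rw [h6, one_mul]
    calc _ ≤ ‖toL2 τ (α w)‖ ^ 2 := by gcongr
      _ ≤ _ := by rw [zero_add]; exact h2.le
  have h0 : ‖τ (α x) - τ x‖ ^ 2 ≤ 0 := by
    refine le_of_forall_pos_le_add fun δ hδ => ?_
    have := hkey (δ / R ^ 2) (by positivity)
    rwa [mul_div_cancel₀ _ (by positivity)] at this
  have h8 : ‖τ (α x) - τ x‖ = 0 := pow_eq_zero_iff (two_ne_zero) |>.1
    (le_antisymm h0 (sq_nonneg _))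
  exact sub_eq_zero.1 (norm_eq_zero.1 h8)

end TraceRep

/-! ### Conjugations of a complex Hilbert space and complexification. -/

section Conjugation

variable {E : Type*} [NormedAddCommGroup E] [InnerProductSpace ℂ E] (C : E →L⋆[ℂ] E)
  (hC : ∀ v, C (C v) = v) {R : Submodule ℝ E} (hR : ∀ v, v ∈ R ↔ C v = v)

namespace ContinuousLinearMap

/-- The real part `v ↦ (v + C v) / 2` with respect to a conjugation `C`. -/
def conjRealPart : E →L[ℝ] E where
  toFun v := (2⁻¹ : ℂ) • (v + C v)
  map_add' v w := by
    simp only [map_add]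
    module
  map_smul' c v := by
    simp only [← Complex.coe_smul, map_smulₛₗ, Complex.conj_ofReal, RingHom.id_apply]
    module
  cont := (continuous_id.add C.continuous).const_smul (2⁻¹ : ℂ)

theorem conjRealPart_apply (v : E) : C.conjRealPart v = (2⁻¹ : ℂ) • (v + C v) := rfl

theorem conjRealPart_of_fixed {v : E} (hv : C v = v) : C.conjRealPart v = v := by
  rw [conjRealPart_apply, hv, ← two_smul ℂ, smul_smul, inv_mul_cancel₀ two_ne_zero, one_smul]

theorem conjRealPart_neg_I_smul_of_fixed {v : E} (hv : C v = v) :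
    C.conjRealPart (-Complex.I • v) = 0 := by
  rw [conjRealPart_apply, map_smulₛₗ, hv, map_neg, Complex.conj_I, neg_neg, neg_smul,
    neg_add_cancel, smul_zero]

theorem conjRealPart_add_I_smul (v : E) :
    C.conjRealPart v + Complex.I • C.conjRealPart (-Complex.I • v) = v := by
  simp only [conjRealPart_apply, map_smulₛₗ, map_neg, Complex.conj_I, neg_neg]
  match_scalars
  · linear_combination (-1 / 2 : ℂ) * Complex.I_mul_I
  · linear_combination (1 / 2 : ℂ) * Complex.I_mul_I

include hC

theorem apply_conjRealPart (v : E) : C (C.conjRealPart v) = C.conjRealPart v := by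
  simp only [conjRealPart_apply, map_smulₛₗ, map_add, hC, map_inv₀, map_ofNat, add_comm]

theorem exists_fixed_add_I_smul (v : E) :
    ∃ p, C p = p ∧ ∃ q, C q = q ∧ p + Complex.I • q = v :=
  ⟨_, C.apply_conjRealPart hC v, _, C.apply_conjRealPart hC _, C.conjRealPart_add_I_smul v⟩

include hR

theorem eq_of_eqOn_fixed {T T' : E →L[ℂ] E} (h : ∀ v ∈ R, T v = T' v) : T = T' := by
  ext v
  obtain ⟨p, hp, q, hq, rfl⟩ := C.exists_fixed_add_I_smul hC v
  rw [map_add, map_add, map_smul, map_smul, h p ((hR p).2 hp), h q ((hR q).2 hq)]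

/-- A real linear operator on the fixed points of a conjugation has a unique complex linear
extension. -/
theorem existsUnique_complex_extension (S : R →L[ℝ] E) :
    ∃! T : E →L[ℂ] E, ∀ v : R, T v = S v := by
  let G : E →L[ℝ] E := S.comp (C.conjRealPart.codRestrict R fun v =>
    (hR _).2 (C.apply_conjRealPart hC v))
  have hG : ∀ (v : E) (h : C.conjRealPart v ∈ R), G v = S ⟨C.conjRealPart v, h⟩ := fun v h => rfl
  have hadd : ∀ v w, G (v + w) = G v + G w := map_add G
  have hsmul : ∀ (c : ℝ) v, G ((c : ℂ) • v) = (c : ℂ) • G v := fun c v => by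
    rw [Complex.coe_smul, Complex.coe_smul, map_smul]
  have hcont : Continuous G := G.continuous
  clear_value G
  -- The imaginary part of `v` is the real part of `-i v`, so the extension must be `S(Re v) + i
  -- S(Re(-i v))`.
  let T : E →L[ℂ] E :=
    { toFun := fun v => G v + Complex.I • G (-Complex.I • v)
      map_add' := fun v w => by
        rw [smul_add, hadd, hadd, smul_add]
        abel
      map_smul' := fun c v => by
        have h1 : c • v = (c.re : ℂ) • v + ((-c.im : ℝ) : ℂ) • (-Complex.I • v) := by
          conv_lhs => rw [← Complex.re_add_im c]
          push_cast
          module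
        have h2 : -Complex.I • (c • v) = (c.im : ℂ) • v + (c.re : ℂ) • (-Complex.I • v) := by
          conv_lhs => rw [← Complex.re_add_im c]
          match_scalars
          linear_combination (-c.im : ℂ) * Complex.I_mul_I
        rw [h2, h1, hadd, hadd, hsmul, hsmul, hsmul, hsmul]
        simp only [RingHom.id_apply]
        conv_rhs => rw [← Complex.re_add_im c]
        push_cast
        match_scalars
        · ring
        · linear_combination (-c.im : ℂ) * Complex.I_mul_I
      cont := hcont.add ((hcont.comp (continuous_const_smul (-Complex.I))).const_smul Complex.I) }
  have hT : ∀ v : R, T v = S v := by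
    intro v
    have hv := (hR v).1 v.2
    change G v + Complex.I • G (-Complex.I • (v : E)) = S v
    have e1 := C.conjRealPart_of_fixed hv
    have e2 := C.conjRealPart_neg_I_smul_of_fixed hv
    rw [hG v (e1.symm ▸ v.2), hG _ (e2.symm ▸ R.zero_mem)]
    simp only [e1, e2]
    have : S ⟨0, R.zero_mem⟩ = 0 := map_zero S
    rw [this, smul_zero, add_zero]
  refine ⟨T, hT, fun T' hT' => C.eq_of_eqOn_fixed hC hR fun v hv => ?_⟩
  rw [hT' ⟨v, hv⟩, hT ⟨v, hv⟩]

end ContinuousLinearMap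

end Conjugation

/-! ### The conjugation `x ↦ α(x)^*` and its fixed space `L²(M, α)`. -/

namespace TraceRep

open Filter Topology Metric

variable {A : Type*} [CStarAlgebra A]

theorem half_smul_add_star_mem_realAlgebra (α : InvolutiveStarAntiaut A) (x : A) :
    (2⁻¹ : ℝ) • (x + star (α x)) ∈ α.realAlgebra := by
  change α ((2⁻¹ : ℝ) • (x + star (α x))) = star ((2⁻¹ : ℝ) • (x + star (α x)))
  rw [star_smul, star_trivial (2⁻¹ : ℝ), ← Complex.coe_smul, map_smul, map_add, α.map_star, α.involutive,
    Complex.coe_smul, star_add, star_star, add_comm]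

variable [PartialOrder A] [StarOrderedRing A] {τ : A →ₚ[ℂ] ℂ}

section RealConj

variable (α : InvolutiveStarAntiaut A) (hα : ∀ x, τ (α x) = τ x)

/-- The map `x ↦ α(x)^*` before completion. -/
def preRealConj : τ.PreGNS →L⋆[ℂ] τ.PreGNS :=
  LinearMap.mkContinuous
    { toFun := fun x => τ.toPreGNS (star (α (τ.ofPreGNS x)))
      map_add' := fun x y => by simp
      map_smul' := fun c x => by simp } 1 (fun x => by
        rw [one_mul]
        apply le_of_eq
        have h : τ (α (τ.ofPreGNS x) * star (α (τ.ofPreGNS x)))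
            = τ (star (τ.ofPreGNS x) * τ.ofPreGNS x) := by
          rw [← α.map_star, ← α.map_mul, hα]
        simp [PositiveLinearMap.preGNS_norm_def, h])

/-- The conjugate linear isometry of `L²(A)` that extends `x ↦ α(x)^*`; its fixed points form
`L²(A, α)`. -/
def realConj : L2 τ →L⋆[ℂ] L2 τ :=
  (preRealConj α hα).completion

theorem realConj_toL2 (x : A) : realConj α hα (toL2 τ x) = toL2 τ (star (α x)) :=
  ContinuousLinearMap.completion_apply_coe (preRealConj α hα) (τ.toPreGNS x)

theorem realConj_realConj (v : L2 τ) : realConj α hα (realConj α hα v) = v := by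
  refine ext_toL2 (f := fun v => realConj α hα (realConj α hα v)) (by fun_prop) continuous_id
    (fun x => ?_) v
  simp only [realConj_toL2, α.map_star, α.involutive, star_star, id]

theorem realConj_smul (c : ℂ) (v : L2 τ) :
    realConj α hα (c • v) = (starRingEnd ℂ) c • realConj α hα v :=
  map_smulₛₗ _ _ _

theorem realConj_real_smul (c : ℝ) (v : L2 τ) :
    realConj α hα (c • v) = c • realConj α hα v := by
  rw [← Complex.coe_smul, realConj_smul, Complex.conj_ofReal, Complex.coe_smul]

theorem inner_realConj_realConj (v w : L2 τ) :
    ⟪realConj α hα v, realConj α hα w⟫_ℂ = ⟪w, v⟫_ℂ := by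
  refine ext_toL2 (f := fun v => ⟪realConj α hα v, realConj α hα w⟫_ℂ) (g := fun v => ⟪w, v⟫_ℂ)
    (by fun_prop) (by fun_prop) (fun x => ?_) v
  refine ext_toL2 (f := fun w => ⟪realConj α hα (toL2 τ x), realConj α hα w⟫_ℂ)
    (g := fun w => ⟪w, toL2 τ x⟫_ℂ) (by fun_prop) (by fun_prop) (fun y => ?_) w
  rw [realConj_toL2, realConj_toL2, inner_toL2, inner_toL2, star_star, ← α.map_star, ← α.map_mul,
    hα]

theorem realConj_eq_of_mem {v : L2 τ} (hv : v ∈ realL2 τ α) : realConj α hα v = v := by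
  have h : (realL2 τ α : Set (L2 τ)) ⊆ {v | realConj α hα v = v} := by
    refine closure_minimal ?_ (isClosed_eq (by fun_prop) continuous_id)
    rintro _ ⟨x, hx, rfl⟩
    have hx' : α x = star x := hx
    change realConj α hα (toL2 τ x) = toL2 τ x
    rw [realConj_toL2, hx', star_star]
  exact h hv

/-- For the converse, a fixed `v` equals `(v + C v) / 2`, and this averaging maps the dense subspace
`A` into `(A, α)`. -/
theorem mem_realL2_iff {v : L2 τ} : v ∈ realL2 τ α ↔ realConj α hα v = v := by
  refine ⟨realConj_eq_of_mem α hα, fun h => ?_⟩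
  have hcont : Continuous fun v : L2 τ => (2⁻¹ : ℂ) • (v + realConj α hα v) :=
    (continuous_id.add (realConj α hα).continuous).const_smul (2⁻¹ : ℂ)
  have h1 : (2⁻¹ : ℂ) • (v + realConj α hα v) ∈ realL2 τ α := by
    refine map_mem_closure (f := fun v : L2 τ => (2⁻¹ : ℂ) • (v + realConj α hα v)) hcont
      (denseRange_toL2 τ v) ?_
    rintro _ ⟨x, rfl⟩
    refine ⟨_, half_smul_add_star_mem_realAlgebra α x, ?_⟩
    change toL2 τ ((2⁻¹ : ℝ) • (x + star (α x))) = (2⁻¹ : ℂ) • (toL2 τ x + realConj α hα (toL2 τ x))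
    rw [realConj_toL2, ← map_add, ← map_smul, ← Complex.coe_smul, Complex.ofReal_inv,
      Complex.ofReal_ofNat]
  rwa [h, ← two_smul ℂ, smul_smul, inv_mul_cancel₀ two_ne_zero, one_smul] at h1

include hα in
theorem existsUnique_isComplexification (S : RealOps τ α) :
    ∃! T : L2 τ →L[ℂ] L2 τ, IsComplexification S T :=
  (realConj α hα).existsUnique_complex_extension (realConj_realConj α hα)
    (fun _ => mem_realL2_iff α hα) ((realL2 τ α).subtypeL.comp S)

include hα in
theorem eq_of_eqOn_realL2 {T T' : L2 τ →L[ℂ] L2 τ} (h : ∀ v ∈ realL2 τ α, T v = T' v) :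
    T = T' :=
  (realConj α hα).eq_of_eqOn_fixed (realConj_realConj α hα) (fun _ => mem_realL2_iff α hα) h

theorem apply_realConj_of_isComplexification {S : RealOps τ α} {T : L2 τ →L[ℂ] L2 τ}
    (h : IsComplexification S T) (v : L2 τ) : T (realConj α hα v) = realConj α hα (T v) := by
  have hT : ∀ w : realL2 τ α, realConj α hα (T w) = T w := fun w => by
    rw [h w]; exact realConj_eq_of_mem α hα (S w).2
  obtain ⟨p, hp, q, hq, rfl⟩ := (realConj α hα).exists_fixed_add_I_smul (realConj_realConj α hα) v
  have hTp := hT ⟨p, (mem_realL2_iff α hα).2 hp⟩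
  have hTq := hT ⟨q, (mem_realL2_iff α hα).2 hq⟩
  dsimp only at hTp hTq
  rw [map_add, realConj_smul, hp, hq, map_add, map_add, map_smul, map_smul, map_add,
    realConj_smul, hTp, hTq]

end RealConj

/-! ### The real commutant as the part of `λ(M)'` commuting with the conjugation. -/

section Commutant

theorem star_mem_lamCommutant {T : L2 τ →L[ℂ] L2 τ} (hT : T ∈ lamCommutant τ) :
    star T ∈ lamCommutant τ := by
  rintro _ ⟨x, rfl⟩
  have h := congrArg star (hT (lam τ (star x)) ⟨_, rfl⟩)
  rw [star_mul, star_mul, ← map_star, star_star] at h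
  exact h.symm

theorem star_apply_of_right_mul (hτ : ∀ x y : A, τ (x * y) = τ (y * x)) {T : L2 τ →L[ℂ] L2 τ}
    {z : A} (hz : ∀ y, T (toL2 τ y) = toL2 τ (y * z)) (y : A) :
    star T (toL2 τ y) = toL2 τ (y * star z) := by
  refine eq_of_inner_toL2 fun a => ?_
  rw [ContinuousLinearMap.star_eq_adjoint, ContinuousLinearMap.adjoint_inner_right, hz,
    inner_toL2, inner_toL2, star_mul, mul_assoc, hτ, mul_assoc]

theorem betaPrime_apply_of_right_mul (hτ : ∀ x y : A, τ (x * y) = τ (y * x))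
    (hf : ∀ x : A, τ (star x * x) = 0 → x = 0) (α : InvolutiveStarAntiaut A)
    {T : L2 τ →L[ℂ] L2 τ} {z : A} (hz : ∀ y, T (toL2 τ y) = toL2 τ (y * z)) (y : A) :
    betaPrime hτ α T (toL2 τ y) = toL2 τ (y * α z) := by
  rw [betaPrime, conjJ_eq_lam hτ hz, beta_lam hf]
  change J hτ (lam τ (α (star z)) (J hτ (toL2 τ y))) = _
  rw [J_toL2, lam_toL2, J_toL2, star_mul, star_star, α.map_star, star_star]

variable (hτ : ∀ x y : A, τ (x * y) = τ (y * x)) (hf : ∀ x : A, τ (star x * x) = 0 → x = 0)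
  (hc : IsBallCompact τ) (α : InvolutiveStarAntiaut A) (hα : ∀ x, τ (α x) = τ x)

-- If `T` is right multiplication by `z`, both conditions say `α(z) = z^*`; evaluation at the vector
-- `1` recovers this equation, as `A` embeds in `L²(A)`. Unlike `β'`, commutation with `C` makes
-- sense for all bounded operators.
include hf hc in
theorem mem_realCommutant_iff {T : L2 τ →L[ℂ] L2 τ} :
    T ∈ realCommutant hτ α ↔
      T ∈ lamCommutant τ ∧ ∀ v, T (realConj α hα v) = realConj α hα (T v) := by
  refine and_congr_right fun hT => ?_
  obtain ⟨z, hz⟩ := exists_right_mul_of_mem_lamCommutant hτ hc hT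
  constructor
  · intro h v
    have h1 : α z = star z := by
      refine toL2_injective hf ?_
      have h2 := betaPrime_apply_of_right_mul hτ hf α hz 1
      rw [h, star_apply_of_right_mul hτ hz, one_mul, one_mul] at h2
      exact h2.symm
    refine ext_toL2 (f := fun v => T (realConj α hα v)) (g := fun v => realConj α hα (T v))
      (by fun_prop) (by fun_prop) (fun y => ?_) v
    rw [realConj_toL2, hz, hz, realConj_toL2, α.map_mul, star_mul, h1, star_star]
  · intro h
    have h1 : z = star (α z) := by
      refine toL2_injective hf ?_
      have h2 := h (toL2 τ 1)
      rwa [realConj_toL2, hz, hz, realConj_toL2, α.map_one', star_one, one_mul] at h2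
    ext v
    refine ext_toL2 (by fun_prop) (by fun_prop) (fun y => ?_) v
    rw [betaPrime_apply_of_right_mul hτ hf α hz, star_apply_of_right_mul hτ hz]
    conv_rhs => rw [h1, star_star]

include hf hc hα in
theorem isRealWStarAlgebra_realCommutant : IsRealWStarAlgebra (realCommutant hτ α) := by
  have hmem := fun T => mem_realCommutant_iff hτ hf hc α hα (T := T)
  have hcc := realConj_realConj α hα
  have hflip : ∀ v w, ⟪w, realConj α hα v⟫_ℂ = ⟪v, realConj α hα w⟫_ℂ := fun v w => by
    conv_lhs => rw [← hcc w]
    exact inner_realConj_realConj α hα _ _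
  refine ⟨?_, ?_, ?_, ?_, ?_, ?_, ?_⟩
  · rw [hmem]
    exact ⟨Set.one_mem_centralizer, fun v => rfl⟩
  · intro S hS T hT
    rw [hmem] at *
    exact ⟨Set.add_mem_centralizer hS.1 hT.1, fun v => by
      simp only [_root_.add_apply, map_add, hS.2, hT.2]⟩
  · intro c T hT
    rw [hmem] at *
    refine ⟨fun m hm => ?_, fun v => ?_⟩
    · rw [mul_smul_comm, smul_mul_assoc, hT.1 m hm]
    · rw [_root_.smul_apply, _root_.smul_apply, realConj_real_smul,
        hT.2]
  · intro S hS T hT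
    rw [hmem] at *
    exact ⟨Set.mul_mem_centralizer hS.1 hT.1, fun v => by
      simp only [mul_apply_eq_comp, hS.2, hT.2]⟩
  · intro T hT
    rw [hmem] at *
    refine ⟨star_mem_lamCommutant hT.1, fun v => ext_inner_left ℂ fun w => ?_⟩
    rw [hflip, ContinuousLinearMap.star_eq_adjoint, ContinuousLinearMap.adjoint_inner_right,
      ContinuousLinearMap.adjoint_inner_left, hflip, hT.2]
  · have hset : {T : L2 τ →WOT[ℂ] L2 τ | T.toCLM ∈ realCommutant hτ α} =
        {T | (∀ x v w, ⟪w, T (lam τ x v)⟫_ℂ = ⟪star (lam τ x) w, T v⟫_ℂ) ∧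
          ∀ v w, ⟪w, T (realConj α hα v)⟫_ℂ = (starRingEnd ℂ) ⟪realConj α hα w, T v⟫_ℂ} := by
      ext T
      rw [Set.mem_ofPred_eq, hmem]
      refine and_congr ⟨fun h x v w => ?_, fun h => ?_⟩ ⟨fun h v w => ?_, fun h v => ?_⟩
      · rw [ContinuousLinearMap.star_eq_adjoint, ContinuousLinearMap.adjoint_inner_left]
        exact congrArg (fun u => ⟪w, u⟫_ℂ) (lamCommutant_apply h x v)
      · rintro _ ⟨x, rfl⟩
        ext v
        refine ext_inner_left ℂ fun w => ?_
        have := h x v w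
        rw [ContinuousLinearMap.star_eq_adjoint, ContinuousLinearMap.adjoint_inner_left] at this
        exact this.symm
      · rw [inner_conj_symm, ← hflip]
        exact congrArg (fun u => ⟪w, u⟫_ℂ) (h v)
      · refine ext_inner_left ℂ fun w => ?_
        have := h v w
        rw [inner_conj_symm, ← hflip] at this
        exact this
    have hcont : ∀ v w, Continuous fun T : L2 τ →WOT[ℂ] L2 τ => ⟪w, T v⟫_ℂ := fun v w =>
      ContinuousLinearMapWOT.continuous_dual_apply v (innerSL ℂ w)
    rw [hset, Set.ofPred_and]
    simp only [Set.ofPred_forall]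
    refine IsClosed.inter ?_ ?_
    · exact isClosed_iInter fun x => isClosed_iInter fun v => isClosed_iInter fun w =>
        isClosed_eq (hcont _ _) (hcont _ _)
    · exact isClosed_iInter fun v => isClosed_iInter fun w =>
        isClosed_eq (hcont _ _) (Complex.continuous_conj.comp (hcont _ _))
  · intro T hT hIT
    rw [hmem] at *
    ext v
    -- If `T` and `i T` both commute with the conjugate linear `C`, then `i T = -i T`.
    have h1 := hIT.2 (realConj α hα v)
    rw [_root_.smul_apply, _root_.smul_apply, realConj_smul, ← hT.2, hcc, Complex.conj_I, neg_smul, eq_neg_iff_add_eq_zero, ← two_smul ℂ,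
      smul_smul] at h1
    exact (smul_eq_zero.1 h1).resolve_left (mul_ne_zero two_ne_zero Complex.I_ne_zero)

/-- This holds because `A = (A, α) + i (A, α)`. -/
theorem mem_lamCommutant_of_realAlgebra {T : L2 τ →L[ℂ] L2 τ}
    (h : ∀ x ∈ α.realAlgebra, lam τ x * T = T * lam τ x) : T ∈ lamCommutant τ := by
  rintro _ ⟨x, rfl⟩
  have hx : x = (2⁻¹ : ℝ) • (x + star (α x))
      + Complex.I • ((2⁻¹ : ℝ) • (-Complex.I • x + star (α (-Complex.I • x)))) := by
    rw [map_smul, star_smul]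
    simp only [← Complex.coe_smul, star_neg, RCLike.star_def, Complex.conj_I, neg_neg]
    push_cast
    match_scalars
    · linear_combination (1 / 2 : ℂ) * Complex.I_mul_I
    · linear_combination (-1 / 2 : ℂ) * Complex.I_mul_I
  have hsm : ∀ y, lam τ (Complex.I • y) = Complex.I • lam τ y := map_smul (lam τ) _
  rw [hx, map_add, hsm, add_mul, mul_add, smul_mul_assoc, mul_smul_comm,
    h _ (half_smul_add_star_mem_realAlgebra α _), h _ (half_smul_add_star_mem_realAlgebra α _)]

-- An operator commuting with `C` preserves the fixed space of `C`, so it restricts to `L²(A, α)`;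
-- conversely a complexification commutes with `C`. Commutation with `λ_r(A, α)` passes to all of
-- `L²(A)` because operators agreeing on `L²(A, α)` are equal.
include hf hc hα in
theorem realCommutant_eq : realCommutant hτ α =
    {T | ∃ S ∈ commutantInRealOps τ α, IsComplexification S T} := by
  ext T
  rw [mem_realCommutant_iff hτ hf hc α hα, Set.mem_ofPred_eq]
  constructor
  · rintro ⟨hT, hC⟩
    have hR : ∀ v ∈ realL2 τ α, T v ∈ realL2 τ α := fun v hv => by
      rw [mem_realL2_iff α hα, ← hC, realConj_eq_of_mem α hα hv]
    refine ⟨(T.restrictScalars ℝ).restrict hR, fun x => ?_, fun v => rfl⟩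
    ext v
    exact lamCommutant_apply hT x v
  · rintro ⟨S, hS, hT⟩
    refine ⟨mem_lamCommutant_of_realAlgebra α fun x hx => ?_,
      apply_realConj_of_isComplexification α hα hT⟩
    refine eq_of_eqOn_realL2 α hα fun v hv => ?_
    have h1 := congrArg (fun R : RealOps τ α => (R ⟨v, hv⟩ : L2 τ)) (hS ⟨x, hx⟩)
    have h2 : T (lam τ x v) = S (lamR τ α ⟨x, hx⟩ ⟨v, hv⟩) := hT (lamR τ α ⟨x, hx⟩ ⟨v, hv⟩)
    change lam τ x (T v) = T (lam τ x v)
    rw [h2, hT ⟨v, hv⟩]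
    exact h1.symm

end Commutant

end TraceRep

end

theorem mainTheorem9 {H : Type*} [NormedAddCommGroup H] [InnerProductSpace ℂ H] [CompleteSpace H]
    (M : VonNeumannAlgebra H) (hM : M.IsFiniteFactor)
    (τ : M →ₚ[ℂ] ℂ) (hτ : M.IsFaithfulNormalTracialState τ)
    (α : InvolutiveStarAntiaut M) :
    IsRealWStarAlgebra (TraceRep.realCommutant hτ.tracial α) ∧
    (∀ S : TraceRep.RealOps τ α, ∃! T : TraceRep.L2 τ →L[ℂ] TraceRep.L2 τ,
      TraceRep.IsComplexification S T) ∧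
    TraceRep.realCommutant hτ.tracial α =
      {T | ∃ S ∈ TraceRep.commutantInRealOps τ α, TraceRep.IsComplexification S T} := by
  have hc := hτ.isBallCompact
  have hz : ∀ z : M, (∀ x, z * x = x * z) → ∃ c : ℂ, z = c • (1 : M) := by
    intro z hz
    obtain ⟨c, hc⟩ := hM.center_trivial z z.2 (VonNeumannAlgebra.mem_commutant_iff.2 fun g hg =>
      congrArg Subtype.val (hz ⟨g, hg⟩).symm)
    exact ⟨c, Subtype.ext hc⟩
  have hα := TraceRep.trace_comp_antiaut hτ.tracial hτ.map_one hτ.faithful hc hz α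
  exact ⟨TraceRep.isRealWStarAlgebra_realCommutant hτ.tracial hτ.faithful hc α hα,
    TraceRep.existsUnique_isComplexification α hα,
    TraceRep.realCommutant_eq hτ.tracial hτ.faithful hc α hα⟩
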